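/- Let $d\ge 2$, $Q=[0,1]^d\subset\mathbb R^d$ with the Euclidean distance and Lebesgue measure $\mathcal L^d$. For a Lipschitz function $g\colon Q\to\mathbb R$ let $\operatorname{Lip}(g)$ be its least Lipschitz constant and $\|g\|_\infty=\sup_Q|g|$. For a Lipschitz map $\pi=(\pi^1,\dots,\pi^d)\colon Q\to\mathbb R^d$ let $\det \mathrm D\pi$ be its Jacobian determinant, which is defined almost everywhere on $Q$. For Lipschitz $f\colon Q\to\mathbb R$ and $\pi\colon Q\to\mathbb R^d$ put $$s(f,\pi)=\max\{\operatorname{Lip}(f),\|f\|_\infty\}\prod_{j=1}^d\operatorname{Lip}(\pi^j).$$ **Theorem 1.1.** (1) There are functions $u_n\in L^1(Q)$, $n=1,2,3,\dots$, such that for every $n\ge 1$ we have $\|u_n\|_{L^1(Q)}\ge 1$ and $$\sup\Big\{\Big|\int_Q u_n\, f\det \mathrm D\pi\;\mathrm d\mathcal L^d\Big| : f\colon Q\to\mathbb R,\ \pi\colon Q\to\mathbb R^d \text{ Lipschitz},\ s(f,\pi)\le 1\Big\}\le \frac1n .$$ (2) Consequently, there is a $\rho\in L^\infty(Q)$ for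 which there are no sequences of Lipschitz maps $f_i\colon Q\to\mathbb R$ and $\pi_i\colon Q\to\mathbb R^d$ ($i\in\mathbb N$) such that $\sum_i s(f_i,\pi_i)<\infty$ and $$\sum_i f_i\det \mathrm D\pi_i=\rho\quad\text{a.e. on } Q,$$ the series converging absolutely in $L^\infty(Q)$. In particular, for this $\rho$ there is no Lipschitz map $\pi\colon Q\to\mathbb R^d$ with $\det \mathrm D\pi=\rho$ a.e. on $Q$. -/

import Mathlib

open MeasureTheory Filter Topology
open scoped NNReal ENNReal

namespace PrescribedJacobian

noncomputable section

/-- The unit cube `Q = [0,1]^d` in Euclidean space. -/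
def cube (d : ℕ) : Set (EuclideanSpace ℝ (Fin d)) :=
  {x | ∀ i, x i ∈ Set.Icc (0 : ℝ) 1}

/-- Lebesgue measure on `Q = [0,1]^d`. -/
def cubeVol (d : ℕ) : Measure (EuclideanSpace ℝ (Fin d)) :=
  volume.restrict (cube d)

/-- `g` is Lipschitz on `Q`. Functions on `Q` are represented by functions on the whole
space whose values off `Q` play no role in any of the notions below. -/
def IsLip {d : ℕ} {F : Type*} [PseudoEMetricSpace F]
    (g : EuclideanSpace ℝ (Fin d) → F) : Prop :=
  ∃ K : ℝ≥0, LipschitzOnWith K g (cube d)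

/-- `Lip(g)`: the least Lipschitz constant of `g` on `Q` (meaningful when `IsLip g`). -/
def lipConst {d : ℕ} (g : EuclideanSpace ℝ (Fin d) → ℝ) : ℝ :=
  ((sInf {K : ℝ≥0 | LipschitzOnWith K g (cube d)} : ℝ≥0) : ℝ)

/-- `‖g‖_∞`: the supremum of `|g|` over `Q` (meaningful when `g` is bounded on `Q`, for
instance when `IsLip g`). -/
def supNorm {d : ℕ} (g : EuclideanSpace ℝ (Fin d) → ℝ) : ℝ :=
  ⨆ x : cube d, |g x|

/-- The size `max {Lip f, ‖f‖_∞} * ∏ j, Lip (π^j)` of a pair `(f, π)`. -/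
def pairSize {d : ℕ} (f : EuclideanSpace ℝ (Fin d) → ℝ)
    (π : EuclideanSpace ℝ (Fin d) → EuclideanSpace ℝ (Fin d)) : ℝ :=
  max (lipConst f) (supNorm f) * ∏ j, lipConst (fun x => π x j)

/-- The Jacobian `det Dπ (x)`, the derivative being taken within `Q`. For Lipschitz `π` it
exists for almost every `x ∈ Q`. -/
def jac {d : ℕ} (π : EuclideanSpace ℝ (Fin d) → EuclideanSpace ℝ (Fin d))
    (x : EuclideanSpace ℝ (Fin d)) : ℝ :=
  (fderivWithin ℝ π (cube d) x).det

/-- Strong Lipschitz non-regularity of the prescribed Jacobian equation on `Q`. -/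
def StrongNonRegularity (d : ℕ) : Prop :=
  ∃ u : ℕ → EuclideanSpace ℝ (Fin d) → ℝ, ∀ n : ℕ, 1 ≤ n →
    Integrable (u n) (cubeVol d) ∧
    1 ≤ ∫ x, |u n x| ∂(cubeVol d) ∧
    ∀ (f : EuclideanSpace ℝ (Fin d) → ℝ)
      (π : EuclideanSpace ℝ (Fin d) → EuclideanSpace ℝ (Fin d)),
      IsLip f → IsLip π → pairSize f π ≤ 1 →
        |∫ x, u n x * f x * jac π x ∂(cubeVol d)| ≤ 1 / (n : ℝ)

/-- `(f_i, π_i)` is a Lipschitz solution of `∑ i, f_i det Dπ_i = ρ`: all maps are Lipschitz,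
their total size is finite, and the series converges absolutely in `L^∞(Q)` to `ρ`. -/
structure IsLipschitzSolution {d : ℕ} (ρ : EuclideanSpace ℝ (Fin d) → ℝ)
    (f : ℕ → EuclideanSpace ℝ (Fin d) → ℝ)
    (π : ℕ → EuclideanSpace ℝ (Fin d) → EuclideanSpace ℝ (Fin d)) : Prop where
  lip_coeff : ∀ i, IsLip (f i)
  lip_field : ∀ i, IsLip (π i)
  finite_size : Summable (fun i => pairSize (f i) (π i))
  abs_conv : ∑' i, eLpNorm (fun x => f i x * jac (π i) x) ∞ (cubeVol d) < ∞
  conv : Tendsto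
    (fun N : ℕ => eLpNorm
      (fun x => (∑ i ∈ Finset.range N, f i x * jac (π i) x) - ρ x) ∞ (cubeVol d))
    atTop (𝓝 0)

/-- The Lipschitz vector field `π` solves `det Dπ = ρ` almost everywhere on `Q`. -/
def IsJacobianSolution {d : ℕ} (ρ : EuclideanSpace ℝ (Fin d) → ℝ)
    (π : EuclideanSpace ℝ (Fin d) → EuclideanSpace ℝ (Fin d)) : Prop :=
  IsLip π ∧ ∀ᵐ x ∂(cubeVol d), jac π x = ρ x

end

end PrescribedJacobian

/-!
Add to the density a plane wave with amplitude `v` and tiny period. The pairing of the wave with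
`f det Dπ` is small unless the difference quotients of `π` along the wave lose `L²`-energy between
the scale of the wave and a fixed multiple of it. Since the energy of a Lipschitz map is bounded,
such losses cannot go on forever, and they telescope when the construction is iterated on finer and
finer scales. The `L¹` mass, on the other hand, can be made to grow linearly in the number of steps:
the amplitude is concentrated on thinner and thinner families of strips while its integral is
preserved, so each wave adds a fixed mass on the gaps which the later waves avoid. To control the
energies with respect to the new amplitude the strips are perpendicular to another coordinate axis,
which is where `d ≥ 2` enters. Normalising the mass gives the first part of the theorem, and the
uniform boundedness principle in `L^∞` gives the second.
-/

namespace PrescribedJacobian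

local notation "𝔼" d:max => EuclideanSpace ℝ (Fin d)

variable {d : ℕ}

section Determinants

theorem abs_det_le {n : Type*} [Fintype n] [DecidableEq n] {A : Matrix n n ℝ} {b : n → ℝ}
    (hA : ∀ j i, |A j i| ≤ b j) : |A.det| ≤ (Fintype.card n).factorial * ∏ j, b j := by
  have hterm (σ : Equiv.Perm n) : |Equiv.Perm.sign σ • ∏ i, A (σ i) i| ≤ ∏ j, b j := by
    rw [← AbsoluteValue.abs_apply, AbsoluteValue.map_units_int_smul, AbsoluteValue.map_prod,
      ← Equiv.prod_comp σ b]
    exact Finset.prod_le_prod (fun i _ => abs_nonneg _) fun i _ => hA _ _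
  rw [Matrix.det_apply]
  refine (Finset.abs_sum_le_sum_abs _ _).trans ((Finset.sum_le_sum fun σ _ => hterm σ).trans ?_)
  simp [Fintype.card_perm]

theorem measurable_det {α n : Type*} [Fintype n] [DecidableEq n] [MeasurableSpace α]
    {A : α → Matrix n n ℝ} (hA : ∀ j i, Measurable fun x => A x j i) :
    Measurable fun x => (A x).det := by
  simp_rw [Matrix.det_apply']
  exact Finset.measurable_fun_sum _ fun σ _ =>
    measurable_const.mul (Finset.measurable_fun_prod _ fun i _ => hA _ _)

-- `det A` is the leading coefficient of the polynomial `det (1 + t A)`, so Lagrange interpolation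
-- at `d + 1` small nodes recovers it; taking `A = 0` shows that the weights sum to zero.
theorem exists_det_weights (hd : 0 < d) {t₀ : ℝ} (ht₀ : 0 < t₀) :
    ∃ t w : ℕ → ℝ, (∀ i, 0 < t i ∧ t i ≤ t₀) ∧ ∑ i ∈ Finset.range (d + 1), w i = 0 ∧
      ∀ A : Matrix (Fin d) (Fin d) ℝ,
        A.det = ∑ i ∈ Finset.range (d + 1), w i * (1 + t i • A).det := by
  let t : ℕ → ℝ := fun i => t₀ / (i + 1)
  let w : ℕ → ℝ := fun i => (∏ j ∈ (Finset.range (d + 1)).erase i, (t i - t j))⁻¹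
  have ht_inj : Set.InjOn t (Finset.range (d + 1)) := fun i _ j _ hij => by
    simpa [t, ht₀.ne', div_eq_mul_inv] using hij
  have hdet (A : Matrix (Fin d) (Fin d) ℝ) :
      A.det = ∑ i ∈ Finset.range (d + 1), w i * (1 + t i • A).det := by
    let P : Polynomial ℝ := ((Polynomial.X : Polynomial ℝ) • A.map Polynomial.C +
      (1 : Matrix (Fin d) (Fin d) ℝ).map Polynomial.C).det
    have hP_deg : P.degree < (Finset.range (d + 1)).card := by
      refine Polynomial.degree_le_natDegree.trans_lt ?_
      have := Polynomial.natDegree_det_X_add_C_le A 1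
      rw [Fintype.card_fin] at this
      rw [Finset.card_range]
      exact_mod_cast Nat.lt_succ_of_le this
    have hP_eval (s : ℝ) : P.eval s = (1 + s • A).det := by
      rw [← Polynomial.coe_evalRingHom, RingHom.map_det]
      congr 1
      ext i j
      rcases eq_or_ne i j with rfl | hij <;> simp [*] <;> ring
    have hP_coeff : P.coeff d = A.det := by
      simpa only [Fintype.card_fin] using Polynomial.coeff_det_X_add_C_card A 1
    have hinterp := Lagrange.coeff_eq_sum ht_inj hP_deg
    rw [Finset.card_range, Nat.add_sub_cancel, hP_coeff] at hinterp
    rw [hinterp]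
    exact Finset.sum_congr rfl fun i _ => by rw [hP_eval, div_eq_inv_mul]
  refine ⟨t, w, fun i => ⟨by positivity, div_le_self ht₀.le (by simp)⟩, ?_, hdet⟩
  have : Nonempty (Fin d) := ⟨⟨0, hd⟩⟩
  simpa using (hdet 0).symm

theorem det_eq_det_of_single (A : 𝔼 d →L[ℝ] 𝔼 d) :
    A.det = (Matrix.of fun j i => A (EuclideanSpace.single i 1) j).det := by
  rw [ContinuousLinearMap.det, ← LinearMap.det_toMatrix (EuclideanSpace.basisFun (Fin d) ℝ).toBasis]
  congr 1

end Determinants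

section ChangeOfVariables

variable {E : Type*} [NormedAddCommGroup E]

theorem bijective_id_add_of_lipschitzWith [CompleteSpace E] {K : ℝ≥0} (hK : K < 1) {ζ : E → E}
    (hζ : LipschitzWith K ζ) : Function.Bijective fun x => x + ζ x := by
  have hcontr (y : E) : ContractingWith K fun x => y - ζ x :=
    ⟨hK, LipschitzWith.of_dist_le_mul fun x z => by
      rw [dist_sub_left]; exact hζ.dist_le_mul x z⟩
  have hfixed (x y : E) : x + ζ x = y ↔ Function.IsFixedPt (fun x => y - ζ x) x := by
    rw [Function.IsFixedPt, sub_eq_iff_eq_add, eq_comm]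
  refine ⟨fun x y hxy => ?_, fun y =>
    ⟨_, (hfixed _ _).2 (hcontr y).fixedPoint_isFixedPt⟩⟩
  exact (hcontr _).fixedPoint_unique' ((hfixed _ _).1 hxy) ((hfixed _ _).1 rfl)

variable [NormedSpace ℝ E] [FiniteDimensional ℝ E]

theorem det_id_add_pos {A : E →L[ℝ] E} (hA : ‖A‖ < 1) :
    0 < (ContinuousLinearMap.id ℝ E + A).det := by
  have hne : ∀ s ∈ Set.Icc (0 : ℝ) 1, (ContinuousLinearMap.id ℝ E + s • A).det ≠ 0 := by
    intro s hs h0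
    have hlt : ‖s • A‖₊ < 1 := by
      rw [← NNReal.coe_lt_coe, coe_nnnorm, norm_smul, Real.norm_of_nonneg hs.1]
      exact (mul_le_of_le_one_left (norm_nonneg A) hs.2).trans_lt hA
    have := FiniteDimensional.complete ℝ E
    have hinj := (bijective_id_add_of_lipschitzWith hlt (s • A).lipschitz).1
    exact (LinearMap.bot_lt_ker_of_det_eq_zero h0).ne'
      (LinearMap.ker_eq_bot.2 hinj)
  have hcont : Continuous fun s : ℝ => (ContinuousLinearMap.id ℝ E + s • A).det :=
    ContinuousLinearMap.continuous_det.comp (by fun_prop)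
  by_contra! hneg
  obtain ⟨s, hs, hs0⟩ := intermediate_value_Icc' zero_le_one hcont.continuousOn
    (show (0 : ℝ) ∈ Set.Icc _ _ from
      ⟨by simpa using hneg, by simp [ContinuousLinearMap.det]⟩)
  exact hne s hs hs0

variable [MeasurableSpace E] [BorelSpace E] (μ : Measure E) [μ.IsAddHaarMeasure]

theorem measure_image_eq_zero_of_lipschitzWith {f : E → E} {K : ℝ≥0} (hf : LipschitzWith K f)
    {s : Set E} (hs : μ s = 0) : μ (f '' s) = 0 := by
  refine Measure.absolutelyContinuous_isAddHaarMeasure μ μH[Module.finrank ℝ E] ?_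
  have hs' : μH[Module.finrank ℝ E] s = 0 :=
    Measure.absolutelyContinuous_isAddHaarMeasure _ μ hs
  simpa [hs'] using hf.hausdorffMeasure_image_le (Nat.cast_nonneg (Module.finrank ℝ E)) s

theorem setIntegral_det_id_add {ζ : E → E} {K : ℝ≥0} (hK : K < 1) (hζ : LipschitzWith K ζ)
    {s : Set E} (hs : MeasurableSet s) (h0 : ∀ x ∉ s, ζ x = 0) :
    ∫ x in s, (ContinuousLinearMap.id ℝ E + fderiv ℝ ζ x).det ∂μ = μ.real s := by
  have := FiniteDimensional.complete ℝ E
  have hbij := bijective_id_add_of_lipschitzWith hK hζ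
  set f : E → E := fun x => x + ζ x
  set D := {x | DifferentiableAt ℝ ζ x}
  have hD : μ Dᶜ = 0 := hζ.ae_differentiableAt
  have hsD : (s ∩ D : Set E) =ᵐ[μ] s := inter_ae_eq_left_of_ae_eq_univ (ae_eq_univ.2 hD)
  have hfs : f '' s = s := by
    have hfix : Set.EqOn f id sᶜ := fun x hx => by simp [f, h0 x hx]
    rw [← compl_inj_iff, ← Set.image_compl_eq hbij, hfix.image_eq_self]
  have himage : (f '' (s ∩ D) : Set E) =ᵐ[μ] s := by
    rw [Set.image_inter hbij.1, hfs]
    refine inter_ae_eq_left_of_ae_eq_univ (ae_eq_univ.2 ?_)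
    rw [← Set.image_compl_eq hbij]
    exact measure_image_eq_zero_of_lipschitzWith μ (LipschitzWith.id.add hζ) hD
  have hpos (x : E) : 0 < (ContinuousLinearMap.id ℝ E + fderiv ℝ ζ x).det :=
    det_id_add_pos ((norm_fderiv_le_of_lipschitz ℝ hζ).trans_lt hK)
  calc ∫ x in s, (ContinuousLinearMap.id ℝ E + fderiv ℝ ζ x).det ∂μ
      = ∫ x in s ∩ D, |(ContinuousLinearMap.id ℝ E + fderiv ℝ ζ x).det| • (1 : ℝ) ∂μ := by
        simp only [abs_of_pos (hpos _), smul_eq_mul, mul_one, setIntegral_congr_set hsD]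
    _ = ∫ _ in f '' (s ∩ D), (1 : ℝ) ∂μ :=
        (integral_image_eq_integral_abs_det_fderiv_smul μ
          (hs.inter (measurableSet_of_differentiableAt ℝ ζ))
          (fun x hx => ((hasFDerivAt_id x).add hx.2.hasFDerivAt).hasFDerivWithinAt)
          hbij.1.injOn fun _ => 1).symm
    _ = μ.real s := by rw [setIntegral_congr_set himage, setIntegral_const, smul_eq_mul, mul_one]

end ChangeOfVariables

/-- The matrix whose rows are the gradients of the components of `p`; it plays the role of `Dp`. -/
noncomputable def gradMat (p : Fin d → 𝔼 d → ℝ) (x : 𝔼 d) : Matrix (Fin d) (Fin d) ℝ :=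
  Matrix.of fun j i => fderiv ℝ (p j) x (EuclideanSpace.single i 1)

/-- The Jacobian determinant of the map of the whole space with components `p`. Working with
families of scalar functions makes it easy to replace a single component. -/
noncomputable def jacDet (p : Fin d → 𝔼 d → ℝ) (x : 𝔼 d) : ℝ :=
  (gradMat p x).det

/-- `C`-Lipschitz functions vanishing outside the closed ball of radius `R`. -/
structure LipSupp (C : ℝ≥0) (R : ℝ) (g : 𝔼 d → ℝ) : Prop where
  lip : LipschitzWith C g
  zero : ∀ x, R < ‖x‖ → g x = 0

section CompactlySupported

variable {C K : ℝ≥0} {R : ℝ} {f g w : 𝔼 d → ℝ}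

theorem fderiv_eq_zero_of_norm_gt (hg : ∀ x, R < ‖x‖ → g x = 0) {x : 𝔼 d} (hx : R < ‖x‖) :
    fderiv ℝ g x = 0 := by
  have h : g =ᶠ[𝓝 x] fun _ => 0 := by
    filter_upwards [(isOpen_lt continuous_const continuous_norm).mem_nhds hx] with y hy
    exact hg y hy
  simp [h.fderiv_eq]

theorem integrable_mul_of_eq_zero_off_ball {B : ℝ} (hf : Continuous f) (hgm : Measurable g)
    (hgb : ∀ x, |g x| ≤ B) (h0 : ∀ x, R < ‖x‖ → f x * g x = 0) :
    Integrable fun x => f x * g x := by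
  have hg : IntegrableOn g (Metric.closedBall 0 R) :=
    Measure.integrableOn_of_bounded measure_closedBall_lt_top.ne hgm.aestronglyMeasurable
      (Eventually.of_forall hgb)
  refine (integrableOn_iff_integrable_of_support_subset fun x hx => ?_).1
    (hg.continuousOn_mul hf.continuousOn (isCompact_closedBall 0 R))
  by_contra hxR
  exact hx (h0 x (by simpa using hxR))

namespace LipSupp

theorem mono (hg : LipSupp C R g) (h : C ≤ K) : LipSupp K R g :=
  ⟨hg.lip.weaken h, hg.zero⟩

theorem hasCompactSupport (hg : LipSupp C R g) : HasCompactSupport g :=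
  HasCompactSupport.intro (isCompact_closedBall 0 R) fun x hx => hg.zero x (by simpa using hx)

theorem integrable (hg : LipSupp C R g) : Integrable g :=
  hg.lip.continuous.integrable_of_hasCompactSupport hg.hasCompactSupport

theorem mul_lipschitz (hg : LipSupp C R g) (hw : LipschitzWith K w) :
    ∃ C', LipSupp C' R fun x => w x * g x := by
  obtain ⟨M, hM⟩ := hg.hasCompactSupport.exists_bound_of_continuous hg.lip.continuous
  obtain ⟨N, hN⟩ := (isCompact_closedBall (0 : 𝔼 d) R).exists_bound_of_continuousOn
    hw.continuous.continuousOn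
  have key (x y : 𝔼 d) (hx : ‖x‖ ≤ R) :
      dist (w x * g x) (w y * g y) ≤ (N * C + K * M) * dist x y := by
    have hwx : |w x| ≤ N := hN x (by simpa using hx)
    have hgy : |g y| ≤ M := hM y
    have h1 := hg.lip.dist_le_mul x y
    have h2 := hw.dist_le_mul x y
    rw [Real.dist_eq] at h1 h2 ⊢
    calc |w x * g x - w y * g y| = |w x * (g x - g y) + (w x - w y) * g y| := by ring_nf
      _ ≤ |w x| * |g x - g y| + |w x - w y| * |g y| := by
        rw [← abs_mul, ← abs_mul]; exact abs_add_le _ _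
      _ ≤ N * (C * dist x y) + K * dist x y * M := by
        gcongr
        exact (abs_nonneg _).trans hwx
      _ = (N * C + K * M) * dist x y := by ring
  refine ⟨(N * C + K * M).toNNReal, LipschitzWith.of_dist_le_mul fun x y => ?_, fun x hx => by
    rw [hg.zero x hx, mul_zero]⟩
  by_cases hxy : R < ‖x‖ ∧ R < ‖y‖
  · rw [hg.zero x hxy.1, hg.zero y hxy.2, mul_zero, mul_zero, dist_self]
    positivity
  refine le_trans ?_ (mul_le_mul_of_nonneg_right (Real.le_coe_toNNReal _) dist_nonneg)
  rcases not_and_or.1 hxy with hx | hy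
  · exact key x y (not_lt.1 hx)
  · simpa only [dist_comm] using key y x (not_lt.1 hy)

end LipSupp

end CompactlySupported

section NullLagrangian

variable {C K : ℝ≥0} {R : ℝ} {p : Fin d → 𝔼 d → ℝ} {w : 𝔼 d → ℝ}

theorem abs_fderiv_single_le {g : 𝔼 d → ℝ} (hg : LipschitzWith C g) (x : 𝔼 d) (i : Fin d) :
    |fderiv ℝ g x (EuclideanSpace.single i 1)| ≤ C := by
  simpa using (fderiv ℝ g x).le_of_opNorm_le (norm_fderiv_le_of_lipschitz ℝ hg)
    (EuclideanSpace.single i 1)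

theorem measurable_gradMat (p : Fin d → 𝔼 d → ℝ) (j i : Fin d) :
    Measurable fun x => gradMat p x j i :=
  measurable_fderiv_apply_const ℝ (p j) _

theorem measurable_jacDet (p : Fin d → 𝔼 d → ℝ) : Measurable (jacDet p) :=
  measurable_det (measurable_gradMat p)

theorem abs_jacDet_le {b : Fin d → ℝ≥0} (hp : ∀ j, LipschitzWith (b j) (p j)) (x : 𝔼 d) :
    |jacDet p x| ≤ d.factorial * ∏ j, (b j : ℝ) := by
  simpa [jacDet] using abs_det_le (A := gradMat p x) fun j i => abs_fderiv_single_le (hp j) x i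

theorem gradMat_update (p : Fin d → 𝔼 d → ℝ) (j : Fin d) (w : 𝔼 d → ℝ) (x : 𝔼 d) :
    gradMat (Function.update p j w) x =
      (gradMat p x).updateRow j fun i => fderiv ℝ w x (EuclideanSpace.single i 1) := by
  ext k i
  rcases eq_or_ne k j with rfl | h <;> simp [gradMat, *]

theorem jacDet_eq_zero_of_norm_gt {j : Fin d} (hp : ∀ x, R < ‖x‖ → p j x = 0) {x : 𝔼 d}
    (hx : R < ‖x‖) : jacDet p x = 0 :=
  Matrix.det_eq_zero_of_row_eq_zero j fun i => by simp [gradMat, fderiv_eq_zero_of_norm_gt hp hx]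

theorem det_id_add_fderiv_smul_toLp {x : 𝔼 d} (hp : ∀ j, DifferentiableAt ℝ (p j) x) (t : ℝ) :
    (ContinuousLinearMap.id ℝ (𝔼 d) +
      fderiv ℝ (fun y => t • WithLp.toLp 2 fun j => p j y) x).det = (1 + t • gradMat p x).det := by
  have hder : HasFDerivAt (fun y => t • WithLp.toLp 2 fun j => p j y)
      (t • ((EuclideanSpace.equiv (Fin d) ℝ).symm : (Fin d → ℝ) →L[ℝ] 𝔼 d).comp
        (ContinuousLinearMap.pi fun j => fderiv ℝ (p j) x)) x :=
    (((EuclideanSpace.equiv (Fin d) ℝ).symm.toContinuousLinearMap.hasFDerivAt).comp x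
      (hasFDerivAt_pi.mpr fun j => (hp j).hasFDerivAt)).const_smul t
  rw [hder.fderiv, det_eq_det_of_single]
  congr 1
  ext j k
  rcases eq_or_ne j k with rfl | hjk <;> simp [gradMat, *]

theorem exists_setIntegral_det_one_add_smul_gradMat (hp : ∀ j, LipSupp C R (p j)) :
    ∃ t₀ : ℝ, 0 < t₀ ∧ ∀ t, 0 < t → t ≤ t₀ →
      ∫ x in Metric.closedBall 0 R, (1 + t • gradMat p x).det =
        volume.real (Metric.closedBall (0 : 𝔼 d) R) := by
  obtain ⟨K, hK⟩ : ∃ K, LipschitzWith K fun y => WithLp.toLp 2 fun j => p j y :=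
    ⟨_, (PiLp.lipschitzWith_toLp 2 _).comp fun x y => edist_pi_le_iff.2 fun j => (hp j).lip x y⟩
  refine ⟨((K : ℝ) + 1)⁻¹, by positivity, fun t ht ht₀ => ?_⟩
  have htK : t.toNNReal * K < 1 := by
    rw [← NNReal.coe_lt_coe, NNReal.coe_mul, Real.coe_toNNReal _ ht.le, NNReal.coe_one]
    calc t * K < t * (K + 1) := by gcongr; exact lt_add_one _
      _ ≤ 1 := by rwa [← le_div_iff₀ (by positivity), one_div]
  have hlip : LipschitzWith (t.toNNReal * K) fun y => t • WithLp.toLp 2 fun j => p j y := by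
    refine LipschitzWith.of_dist_le_mul fun x y => ?_
    rw [dist_smul₀, Real.norm_of_nonneg ht.le, NNReal.coe_mul, Real.coe_toNNReal _ ht.le, mul_assoc]
    exact mul_le_mul_of_nonneg_left (hK.dist_le_mul x y) ht.le
  rw [← setIntegral_det_id_add volume htK hlip measurableSet_closedBall fun x hx => ?_]
  · refine setIntegral_congr_ae measurableSet_closedBall ?_
    filter_upwards [ae_all_iff.2 fun j => (hp j).lip.ae_differentiableAt] with x hx _
    exact (det_id_add_fderiv_smul_toLp hx t).symm
  · ext j
    simp [(hp j).zero x (by simpa using hx)]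

theorem integrableOn_det_one_add_smul_gradMat {b : Fin d → ℝ≥0}
    (hp : ∀ j, LipschitzWith (b j) (p j)) {s : Set (𝔼 d)} (hs : volume s ≠ ∞) (t : ℝ) :
    IntegrableOn (fun x => (1 + t • gradMat p x).det) s := by
  refine Measure.integrableOn_of_bounded hs ((measurable_det fun j k => measurable_const.add
    ((measurable_gradMat p j k).const_mul t)).aestronglyMeasurable)
    (Eventually.of_forall fun x => abs_det_le (b := fun j => 1 + |t| * b j) fun j k => ?_)
  refine (abs_add_le _ _).trans (add_le_add ?_ ?_)
  · rw [Matrix.one_apply]; split_ifs <;> simp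
  · rw [Matrix.smul_apply, smul_eq_mul, abs_mul]
    exact mul_le_mul_of_nonneg_left (abs_fderiv_single_le (hp j) x k) (abs_nonneg t)

theorem integral_jacDet_eq_zero_of_forall_lipSupp (hd : 0 < d) (hp : ∀ j, LipSupp C R (p j)) :
    ∫ x, jacDet p x = 0 := by
  set B := Metric.closedBall (0 : 𝔼 d) R
  obtain ⟨t₀, ht₀, hvol⟩ := exists_setIntegral_det_one_add_smul_gradMat hp
  obtain ⟨t, w, ht, hw, hdet⟩ := exists_det_weights hd ht₀
  have hint (i : ℕ) : IntegrableOn (fun x => w i * (1 + t i • gradMat p x).det) B :=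
    (integrableOn_det_one_add_smul_gradMat (fun j => (hp j).lip)
      measure_closedBall_lt_top.ne _).const_mul _
  calc ∫ x, jacDet p x = ∫ x in B, jacDet p x :=
        (setIntegral_eq_integral_of_forall_compl_eq_zero fun x hx =>
          jacDet_eq_zero_of_norm_gt (hp ⟨0, hd⟩).zero (by simpa [B] using hx)).symm
    _ = ∑ i ∈ Finset.range (d + 1), w i * ∫ x in B, (1 + t i • gradMat p x).det := by
        simp_rw [← integral_const_mul]
        rw [← integral_finsetSum _ fun i _ => hint i]
        exact integral_congr_ae (Eventually.of_forall fun x => hdet (gradMat p x))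
    _ = 0 := by
        rw [Finset.sum_congr rfl fun i _ => by rw [hvol _ (ht i).1 (ht i).2], ← Finset.sum_mul, hw,
          zero_mul]

theorem exists_lipSupp_cutoff (R : ℝ) :
    ∃ χ : 𝔼 d → ℝ, LipSupp 1 (R + 2) χ ∧ ∀ x, ‖x‖ < R + 1 → χ x = 1 := by
  refine ⟨fun x => min (max (R + 2 - ‖x‖) 0) 1, ⟨?_, fun x hx => ?_⟩, fun x hx => ?_⟩
  · have hdist : LipschitzWith 1 fun x : 𝔼 d => R + 2 - ‖x‖ := by
      simpa using (LipschitzWith.const (R + 2)).sub lipschitzWith_one_norm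
    exact (hdist.max_const 0).min_const 1
  · simp [max_eq_right (sub_nonpos.2 hx.le)]
  · exact min_eq_right (le_max_of_le_left (by linarith))

-- Multiplying the remaining components by a cutoff equal to `1` near the support of `p j` does not
-- change the Jacobian determinant.
theorem integral_jacDet_eq_zero {j : Fin d} (hp : ∀ k, LipschitzWith K (p k))
    (hpj : LipSupp C R (p j)) : ∫ x, jacDet p x = 0 := by
  obtain ⟨χ, hχ, hχ1⟩ := exists_lipSupp_cutoff (d := d) R
  choose D hD using fun k => hχ.mul_lipschitz (hp k)
  have hsupp (k : Fin d) : LipSupp (∑ k, D k) (R + 2) fun x => p k x * χ x :=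
    (hD k).mono (Finset.single_le_sum (fun _ _ => zero_le) (Finset.mem_univ k))
  rw [← integral_jacDet_eq_zero_of_forall_lipSupp j.pos hsupp]
  congr 1 with x
  rcases le_or_gt ‖x‖ R with hx | hx
  · have hnear (k : Fin d) : (fun y => p k y * χ y) =ᶠ[𝓝 x] p k := by
      filter_upwards [(isOpen_lt continuous_norm continuous_const).mem_nhds
        (show ‖x‖ < R + 1 by linarith)] with y hy
      rw [hχ1 y hy, mul_one]
    simp only [jacDet, gradMat, (hnear _).fderiv_eq]
  · rw [jacDet_eq_zero_of_norm_gt hpj.zero hx, jacDet_eq_zero_of_norm_gt (j := j) _ hx]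
    exact fun y hy => by rw [hpj.zero y hy, zero_mul]

theorem LipSupp.integrable_mul_jacDet (hw : LipSupp C R w) (hp : ∀ k, LipschitzWith K (p k)) :
    Integrable fun x => w x * jacDet p x :=
  integrable_mul_of_eq_zero_off_ball hw.lip.continuous (measurable_jacDet p) (abs_jacDet_le hp)
    fun x hx => by rw [hw.zero x hx, zero_mul]

theorem lipschitzWith_update {j : Fin d} (hp : ∀ k, LipschitzWith K (p k))
    (hw : LipschitzWith C w) (k : Fin d) :
    LipschitzWith (max C K) (Function.update p j w k) := by
  rcases eq_or_ne k j with rfl | hk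
  · simpa using hw.weaken (le_max_left _ _)
  · simpa [hk] using (hp k).weaken (le_max_right _ _)

theorem LipSupp.integrable_mul_jacDet_update {f : 𝔼 d → ℝ} (hw : LipSupp C R w)
    (hp : ∀ k, LipschitzWith K (p k)) (hf : Continuous f) (j : Fin d) :
    Integrable fun x => f x * jacDet (Function.update p j w) x :=
  integrable_mul_of_eq_zero_off_ball hf (measurable_jacDet _)
    (abs_jacDet_le (lipschitzWith_update hp hw.lip)) fun x hx => by
      rw [jacDet_eq_zero_of_norm_gt (j := j) (by simpa using hw.zero) hx, mul_zero]

theorem jacDet_update_mul {x : 𝔼 d} {j : Fin d} (hp : DifferentiableAt ℝ (p j) x)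
    (hw : DifferentiableAt ℝ w x) :
    jacDet (Function.update p j fun x => w x * p j x) x =
      w x * jacDet p x + p j x * jacDet (Function.update p j w) x := by
  have hgrad : (fun i => fderiv ℝ (fun x => w x * p j x) x (EuclideanSpace.single i 1)) =
      w x • gradMat p x j + p j x • fun i => fderiv ℝ w x (EuclideanSpace.single i 1) := by
    ext i
    simp [fderiv_fun_mul hw hp, gradMat]
  simp only [jacDet, gradMat_update, hgrad, Matrix.det_updateRow_add, Matrix.det_updateRow_smul,
    Matrix.updateRow_eq_self]

theorem integral_mul_jacDet (hw : LipSupp C R w) (hp : ∀ k, LipschitzWith K (p k)) (j : Fin d) :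
    ∫ x, w x * jacDet p x = -∫ x, p j x * jacDet (Function.update p j w) x := by
  obtain ⟨C', hwp⟩ := hw.mul_lipschitz (hp j)
  have hzero : ∫ x, jacDet (Function.update p j fun x => p j x * w x) x = 0 :=
    integral_jacDet_eq_zero (j := j) (lipschitzWith_update hp hwp.lip) (by simpa using hwp)
  have hprod : ∀ᵐ x, jacDet (Function.update p j fun x => p j x * w x) x =
      w x * jacDet p x + p j x * jacDet (Function.update p j w) x := by
    filter_upwards [(hp j).ae_differentiableAt, hw.lip.ae_differentiableAt] with x h1 h2
    simpa only [mul_comm (w _)] using jacDet_update_mul h1 h2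
  rw [integral_congr_ae hprod, integral_add (hw.integrable_mul_jacDet hp)
    (hw.integrable_mul_jacDet_update hp (hp j).continuous j)] at hzero
  exact eq_neg_of_add_eq_zero_left hzero

end NullLagrangian

section Averaging

variable {L : ℝ≥0} {R c m : ℝ} {φ : ℝ → ℝ} {G : 𝔼 d → ℝ}

theorem exists_bounded_primitive_sub_mean (hφ : Continuous φ) (hper : φ.Periodic c) (hc : c ≠ 0)
    (hm : ∫ t in 0..c, φ t = c * m) :
    ∃ (Φ : ℝ → ℝ) (A : ℝ), (∀ t, HasDerivAt Φ (φ t - m) t) ∧ ∀ t, |Φ t| ≤ A := by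
  have hcont : Continuous fun t => φ t - m := by fun_prop
  let Φ : ℝ → ℝ := fun t => ∫ s in 0..t, (φ s - m)
  have hderiv (t : ℝ) : HasDerivAt Φ (φ t - m) t :=
    intervalIntegral.integral_hasDerivAt_right (hcont.intervalIntegrable _ _)
      (hcont.stronglyMeasurableAtFilter _ _) hcont.continuousAt
  have hΦper : Φ.Periodic c := fun t => by
    have hperiod : ∫ s in t..t + c, (φ s - m) = 0 := by
      have hper' : Function.Periodic (fun s => φ s - m) c := fun s => by simp only [hper s]
      rw [hper'.intervalIntegral_add_eq t 0, zero_add, intervalIntegral.integral_sub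
        (hφ.intervalIntegrable _ _) (by simp), hm]
      simp
    simp only [Φ]
    rw [← intervalIntegral.integral_add_adjacent_intervals (hcont.intervalIntegrable 0 t)
      (hcont.intervalIntegrable t (t + c)), hperiod, add_zero]
  obtain ⟨A, hA⟩ := (hΦper.isBounded_of_continuous hc
    (continuous_iff_continuousAt.2 fun t => (hderiv t).continuousAt)).exists_norm_le
  exact ⟨Φ, A, hderiv, fun t => hA _ (Set.mem_range_self t)⟩

theorem LipSupp.lineDeriv_eq_zero (hG : LipSupp L R G) {x : 𝔼 d} (hx : R < ‖x‖) (v : 𝔼 d) :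
    lineDeriv ℝ G x v = 0 := by
  have h : G =ᶠ[𝓝 x] fun _ => 0 := by
    filter_upwards [(isOpen_lt continuous_const continuous_norm).mem_nhds hx] with y hy
    exact hG.zero y hy
  rw [h.lineDeriv_eq]
  simp [lineDeriv]

theorem lipschitzWith_coord (j : Fin d) : LipschitzWith 1 fun x : 𝔼 d => x j :=
  LipschitzWith.of_dist_le_mul fun x y => by
    simpa [dist_eq_norm] using PiLp.norm_apply_le (x - y) j

theorem exists_lineDeriv_eq_periodic_sub_mean (hφ : Continuous φ) (hper : φ.Periodic c)
    (hc : c ≠ 0) (hm : ∫ t in 0..c, φ t = c * m) (j : Fin d) :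
    ∃ A : ℝ, ∀ N : ℝ, 0 < N → ∃ (K : ℝ≥0) (F : 𝔼 d → ℝ), LipschitzWith K F ∧
      (∀ x, lineDeriv ℝ F x (EuclideanSpace.single j 1) = φ (N * x j) - m) ∧
      ∀ x, |F x| ≤ A / N := by
  obtain ⟨Φ, A, hΦ, hA⟩ := exists_bounded_primitive_sub_mean hφ hper hc hm
  obtain ⟨B, hB⟩ := (hper.isBounded_of_continuous hc hφ).exists_norm_le
  have hΦlip : LipschitzWith (B + |m|).toNNReal Φ := by
    refine lipschitzWith_of_nnnorm_deriv_le (fun t => (hΦ t).differentiableAt) fun t => ?_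
    rw [(hΦ t).deriv, ← NNReal.coe_le_coe, coe_nnnorm]
    exact ((norm_sub_le _ _).trans (add_le_add (hB _ (Set.mem_range_self t)) le_rfl)).trans
      (Real.le_coe_toNNReal _)
  refine ⟨A, fun N hN => ⟨_, fun x => N⁻¹ • Φ (N • x j), (lipschitzWith_smul N⁻¹).comp
    (hΦlip.comp ((lipschitzWith_smul N).comp (lipschitzWith_coord j))), fun x => ?_, fun x => ?_⟩⟩
  · have hline : HasDerivAt (fun t : ℝ => N * (x j + t)) N 0 := by
      simpa using ((hasDerivAt_id (0 : ℝ)).const_add (x j)).const_mul N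
    have hcomp := (HasDerivAt.comp (0 : ℝ) (hΦ (N * (x j + 0))) hline).const_mul N⁻¹
    rw [add_zero, mul_comm _ N, inv_mul_cancel_left₀ hN.ne'] at hcomp
    simpa [lineDeriv, Function.comp_def] using hcomp.deriv
  · simp only [smul_eq_mul]
    rw [abs_mul, abs_of_pos (inv_pos.2 hN), inv_mul_eq_div]
    exact div_le_div_of_nonneg_right (hA _) hN.le

-- Integrate by parts along `e_j` against the `O(1/N)` primitive of `φ(N ·) - m`.
theorem exists_abs_integral_periodic_sub_mul_le (hφ : Continuous φ) (hper : φ.Periodic c)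
    (hc : c ≠ 0) (hm : ∫ t in 0..c, φ t = c * m) (j : Fin d) (L : ℝ≥0) (R : ℝ) :
    ∃ A : ℝ, ∀ N : ℝ, 0 < N → ∀ G : 𝔼 d → ℝ, LipSupp L R G →
      |∫ x, (φ (N * x j) - m) * G x| ≤ A / N := by
  obtain ⟨A, hA⟩ := exists_lineDeriv_eq_periodic_sub_mean hφ hper hc hm j
  refine ⟨L * A * volume.real (Metric.closedBall (0 : 𝔼 d) R), fun N hN G hG => ?_⟩
  obtain ⟨K, F, hFlip, hFderiv, hFle⟩ := hA N hN
  have hbound (x : 𝔼 d) : ‖lineDeriv ℝ G x (-EuclideanSpace.single j 1) * F x‖ ≤ L * (A / N) := by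
    rw [norm_mul]
    refine mul_le_mul ?_ (hFle x) (norm_nonneg _) L.coe_nonneg
    simpa using norm_lineDeriv_le_of_lipschitz ℝ hG.lip (v := -EuclideanSpace.single j 1)
  calc |∫ x, (φ (N * x j) - m) * G x|
      = ‖∫ x in Metric.closedBall 0 R, lineDeriv ℝ G x (-EuclideanSpace.single j 1) * F x‖ := by
        rw [setIntegral_eq_integral_of_forall_compl_eq_zero fun x hx => by
            rw [hG.lineDeriv_eq_zero (by simpa using hx), zero_mul],
          ← hFlip.integral_lineDeriv_mul_eq hG.lip hG.hasCompactSupport, Real.norm_eq_abs]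
        simp_rw [hFderiv]
    _ ≤ L * (A / N) * volume.real (Metric.closedBall (0 : 𝔼 d) R) :=
        norm_setIntegral_le_of_norm_le_const measure_closedBall_lt_top fun x _ => hbound x
    _ = L * A * volume.real (Metric.closedBall (0 : 𝔼 d) R) / N := by ring

theorem LipSupp.tendsto_integral_periodic_mul (hG : LipSupp L R G) (hφ : Continuous φ)
    (hper : φ.Periodic c) (hc : c ≠ 0) (hm : ∫ t in 0..c, φ t = c * m) (j : Fin d) :
    Tendsto (fun N : ℝ => ∫ x, φ (N * x j) * G x) atTop (𝓝 (m * ∫ x, G x)) := by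
  obtain ⟨A, hA⟩ := exists_abs_integral_periodic_sub_mul_le hφ hper hc hm j L R
  have hint (N : ℝ) : Integrable fun x : 𝔼 d => φ (N * x j) * G x :=
    Continuous.integrable_of_hasCompactSupport (by have := hG.lip.continuous; fun_prop)
      hG.hasCompactSupport.mul_left
  rw [tendsto_iff_norm_sub_tendsto_zero]
  refine squeeze_zero' (Eventually.of_forall fun _ => norm_nonneg _) ?_
    (tendsto_const_nhds (x := A).div_atTop tendsto_id)
  filter_upwards [eventually_gt_atTop 0] with N hN
  refine le_of_eq_of_le ?_ (hA N hN G hG)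
  rw [← integral_const_mul, ← integral_sub (hint N) (hG.integrable.const_mul m), Real.norm_eq_abs]
  simp_rw [sub_mul]

end Averaging

section Energy

variable {C : ℝ≥0} {R : ℝ} {i : Fin d} {h : ℝ} {g v : 𝔼 d → ℝ}

/-- The difference quotient of `g` in direction `i` with step `h`. -/
noncomputable def diffQuot (i : Fin d) (h : ℝ) (g : 𝔼 d → ℝ) (x : 𝔼 d) : ℝ :=
  h⁻¹ * (g (x + EuclideanSpace.single i h) - g x)

/-- The energy `∑ k, ∫ |δ p_k|² v` of the difference quotients `δ p_k` of the components of `p` in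
direction `i` with step `h`, weighted by the density `v`. -/
noncomputable def energy (i : Fin d) (h : ℝ) (v : 𝔼 d → ℝ) (p : Fin d → 𝔼 d → ℝ) : ℝ :=
  ∑ k, ∫ x, diffQuot i h (p k) x ^ 2 * v x

theorem lipschitzWith_comp_add_right (hg : LipschitzWith C g) (a : 𝔼 d) :
    LipschitzWith C fun x => g (x + a) := by
  simpa [Function.comp_def] using hg.comp (isometry_add_right a).lipschitz

theorem abs_diffQuot_le (hg : LipschitzWith C g) (i : Fin d) (h : ℝ) (x : 𝔼 d) :
    |diffQuot i h g x| ≤ C := by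
  have hdist := hg.dist_le_mul (x + EuclideanSpace.single i h) x
  rw [Real.dist_eq, dist_self_add_left, PiLp.norm_single, Real.norm_eq_abs] at hdist
  rw [diffQuot, abs_mul, abs_inv, inv_mul_eq_div]
  exact div_le_of_le_mul₀ (abs_nonneg _) C.coe_nonneg hdist

theorem lipschitzWith_diffQuot (hg : LipschitzWith C g) (i : Fin d) (h : ℝ) :
    LipschitzWith (‖h⁻¹‖₊ * (C + C)) (diffQuot i h g) :=
  (lipschitzWith_smul h⁻¹).comp ((lipschitzWith_comp_add_right hg _).sub hg)

theorem eq_zero_add_single_of_norm_gt (hg : ∀ x, R < ‖x‖ → g x = 0) {x : 𝔼 d}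
    (hx : R + |h| < ‖x‖) : g (x + EuclideanSpace.single i h) = 0 := by
  refine hg _ ?_
  have := norm_sub_norm_le x (-EuclideanSpace.single i h)
  rw [norm_neg, PiLp.norm_single, Real.norm_eq_abs, sub_neg_eq_add] at this
  linarith

theorem diffQuot_eq_zero (hg : ∀ x, R < ‖x‖ → g x = 0) {x : 𝔼 d} (hx : R + |h| < ‖x‖) :
    diffQuot i h g x = 0 := by
  rw [diffQuot, eq_zero_add_single_of_norm_gt hg hx,
    hg x ((le_add_of_nonneg_right (abs_nonneg h)).trans_lt hx), sub_zero, mul_zero]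

theorem continuous_diffQuot (hg : Continuous g) (i : Fin d) (h : ℝ) :
    Continuous (diffQuot i h g) := by
  unfold diffQuot; fun_prop

theorem hasCompactSupport_diffQuot (hg : HasCompactSupport g) (i : Fin d) (h : ℝ) :
    HasCompactSupport (diffQuot i h g) :=
  ((hg.comp_homeomorph (Homeomorph.addRight (EuclideanSpace.single i h))).sub hg).mul_left

theorem integrable_diffQuot_sq_mul (hg : Continuous g) (hgs : HasCompactSupport g)
    (hv : Continuous v) (i : Fin d) (h : ℝ) : Integrable fun x => diffQuot i h g x ^ 2 * v x := by
  have hδ := continuous_diffQuot hg i h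
  refine Continuous.integrable_of_hasCompactSupport (by fun_prop) ?_
  simp_rw [sq]
  exact (hasCompactSupport_diffQuot hgs i h).mul_right.mul_right

theorem integrable_diffQuot_sub_sq_mul (hg : Continuous g) (hgs : HasCompactSupport g)
    (hv : Continuous v) (i : Fin d) (h h' : ℝ) :
    Integrable fun x => (diffQuot i h g x - diffQuot i h' g x) ^ 2 * v x := by
  have hδ := continuous_diffQuot hg i
  refine Continuous.integrable_of_hasCompactSupport (by have := hδ h; have := hδ h'; fun_prop) ?_
  simp_rw [sq]
  exact ((hasCompactSupport_diffQuot hgs i h).sub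
    (hasCompactSupport_diffQuot hgs i h')).mul_right.mul_right

theorem diffQuot_two_mul (i : Fin d) (h : ℝ) (g : 𝔼 d → ℝ) (x : 𝔼 d) :
    diffQuot i (2 * h) g x =
      (diffQuot i h g x + diffQuot i h g (x + EuclideanSpace.single i h)) / 2 := by
  have hsingle : x + EuclideanSpace.single i h + EuclideanSpace.single i h =
      x + EuclideanSpace.single i (2 * h) := by
    rw [add_assoc, ← PiLp.single_add, two_mul]
  simp only [diffQuot, hsingle, mul_inv]
  ring

-- The parallelogram identity for `δ_h g` and its translate, whose average is `δ_{2h} g`.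
theorem integral_diffQuot_sub_two_mul_sq (hg : Continuous g) (hgs : HasCompactSupport g)
    (hv : Continuous v) (hinv : ∀ x, v (x + EuclideanSpace.single i h) = v x) :
    ∫ x, (diffQuot i h g x - diffQuot i (2 * h) g x) ^ 2 * v x =
      (∫ x, diffQuot i h g x ^ 2 * v x) - ∫ x, diffQuot i (2 * h) g x ^ 2 * v x := by
  have hint := integrable_diffQuot_sq_mul hg hgs hv i
  let e := EuclideanSpace.single i h
  have htrans : ∫ x, diffQuot i h g (x + e) ^ 2 * v x = ∫ x, diffQuot i h g x ^ 2 * v x := by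
    rw [← integral_add_right_eq_self (fun x => diffQuot i h g x ^ 2 * v x) e]
    simp_rw [e, hinv]
  have hint' : Integrable fun x => diffQuot i h g (x + e) ^ 2 * v x := by
    simpa only [e, hinv] using (hint h).comp_add_right e
  have hpar (x : 𝔼 d) : (diffQuot i h g x - diffQuot i (2 * h) g x) ^ 2 * v x =
      2⁻¹ * (diffQuot i h g x ^ 2 * v x) + 2⁻¹ * (diffQuot i h g (x + e) ^ 2 * v x) -
        diffQuot i (2 * h) g x ^ 2 * v x := by
    rw [diffQuot_two_mul]; ring
  simp_rw [hpar]
  rw [integral_sub (by exact ((hint h).const_mul _).add (hint'.const_mul _)) (hint _),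
    integral_add ((hint h).const_mul _) (hint'.const_mul _), integral_const_mul,
    integral_const_mul, htrans]
  ring

theorem integral_diffQuot_two_pow_mul_sq_le (hg : Continuous g) (hgs : HasCompactSupport g)
    (hv : Continuous v) (hv0 : ∀ x, 0 ≤ v x)
    (hinv : ∀ x t, v (x + EuclideanSpace.single i t) = v x) (m : ℕ) :
    ∫ x, diffQuot i (2 ^ m * h) g x ^ 2 * v x ≤ ∫ x, diffQuot i h g x ^ 2 * v x := by
  induction m with
  | zero => simp
  | succ m ih =>
    refine le_trans ?_ ih
    rw [pow_succ', mul_assoc, ← sub_nonneg,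
      ← integral_diffQuot_sub_two_mul_sq hg hgs hv fun x => hinv x _]
    exact integral_nonneg fun x => mul_nonneg (sq_nonneg _) (hv0 x)

theorem integral_diffQuot_sub_two_pow_mul_sq_le (hg : Continuous g) (hgs : HasCompactSupport g)
    (hv : Continuous v) (hv0 : ∀ x, 0 ≤ v x)
    (hinv : ∀ x t, v (x + EuclideanSpace.single i t) = v x) (m : ℕ) :
    ∫ x, (diffQuot i h g x - diffQuot i (2 ^ m * h) g x) ^ 2 * v x ≤
      m * ((∫ x, diffQuot i h g x ^ 2 * v x) - ∫ x, diffQuot i (2 ^ m * h) g x ^ 2 * v x) := by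
  let δ (k : ℕ) (x : 𝔼 d) : ℝ := diffQuot i (2 ^ k * h) g x
  have hint (k : ℕ) : Integrable fun x => (δ k x - δ (k + 1) x) ^ 2 * v x :=
    integrable_diffQuot_sub_sq_mul hg hgs hv i _ _
  have hstep (k : ℕ) : ∫ x, (δ k x - δ (k + 1) x) ^ 2 * v x =
      (∫ x, δ k x ^ 2 * v x) - ∫ x, δ (k + 1) x ^ 2 * v x := by
    simp only [δ, pow_succ' (2 : ℝ) k, mul_assoc]
    exact integral_diffQuot_sub_two_mul_sq hg hgs hv fun x => hinv x _
  have hcs (x : 𝔼 d) : (δ 0 x - δ m x) ^ 2 * v x ≤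
      m * ∑ k ∈ Finset.range m, (δ k x - δ (k + 1) x) ^ 2 * v x := by
    rw [← Finset.sum_mul, ← mul_assoc, ← Finset.sum_range_sub' (fun k => δ k x)]
    refine mul_le_mul_of_nonneg_right ?_ (hv0 x)
    simpa using sq_sum_le_card_mul_sum_sq (s := Finset.range m) (f := fun k => δ k x - δ (k + 1) x)
  calc ∫ x, (diffQuot i h g x - diffQuot i (2 ^ m * h) g x) ^ 2 * v x
      = ∫ x, (δ 0 x - δ m x) ^ 2 * v x := by simp only [δ, pow_zero, one_mul]
    _ ≤ ∫ x, m * ∑ k ∈ Finset.range m, (δ k x - δ (k + 1) x) ^ 2 * v x :=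
        integral_mono (integrable_diffQuot_sub_sq_mul hg hgs hv i _ _)
          ((integrable_finsetSum _ fun k _ => hint k).const_mul _) hcs
    _ = m * ((∫ x, diffQuot i h g x ^ 2 * v x) - ∫ x, δ m x ^ 2 * v x) := by
        rw [integral_const_mul, integral_finsetSum _ fun k _ => hint k,
          Finset.sum_congr rfl fun k _ => hstep k,
          Finset.sum_range_sub' fun k => ∫ x, δ k x ^ 2 * v x]
        simp only [δ, pow_zero, one_mul]

theorem energy_two_pow_mul_le {p : Fin d → 𝔼 d → ℝ} (hp : ∀ k, Continuous (p k))
    (hps : ∀ k, HasCompactSupport (p k)) (hv : Continuous v) (hv0 : ∀ x, 0 ≤ v x)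
    (hinv : ∀ x t, v (x + EuclideanSpace.single i t) = v x) (m : ℕ) :
    energy i (2 ^ m * h) v p ≤ energy i h v p :=
  Finset.sum_le_sum fun k _ => integral_diffQuot_two_pow_mul_sq_le (hp k) (hps k) hv hv0 hinv m

theorem integral_diffQuot_sub_two_pow_mul_sq_le_energy {p : Fin d → 𝔼 d → ℝ}
    (hp : ∀ k, Continuous (p k)) (hps : ∀ k, HasCompactSupport (p k)) (hv : Continuous v)
    (hv0 : ∀ x, 0 ≤ v x) (hinv : ∀ x t, v (x + EuclideanSpace.single i t) = v x) (m : ℕ)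
    (k : Fin d) :
    ∫ x, (diffQuot i h (p k) x - diffQuot i (2 ^ m * h) (p k) x) ^ 2 * v x ≤
      m * (energy i h v p - energy i (2 ^ m * h) v p) := by
  refine (integral_diffQuot_sub_two_pow_mul_sq_le (hp k) (hps k) hv hv0 hinv m).trans
    (mul_le_mul_of_nonneg_left ?_ m.cast_nonneg)
  rw [energy, energy, ← Finset.sum_sub_distrib]
  exact Finset.single_le_sum (f := fun k => (∫ x, diffQuot i h (p k) x ^ 2 * v x) -
    ∫ x, diffQuot i (2 ^ m * h) (p k) x ^ 2 * v x) (fun l _ => sub_nonneg.2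
      (integral_diffQuot_two_pow_mul_sq_le (hp l) (hps l) hv hv0 hinv m)) (Finset.mem_univ k)

end Energy

section Oscillation

variable {C K L ρ : ℝ≥0} {R V h : ℝ} {i j : Fin d} {f g r v w φ ψ : 𝔼 d → ℝ}
  {p P : Fin d → 𝔼 d → ℝ}

theorem jacDet_comp_add_right (p : Fin d → 𝔼 d → ℝ) (a x : 𝔼 d) :
    jacDet (fun k y => p k (y + a)) x = jacDet p (x + a) := by
  simp only [jacDet, gradMat, fderiv_comp_add_right]

theorem abs_jacDet_le_of_lipschitzWith_one (hP : ∀ k, LipschitzWith 1 (P k)) (x : 𝔼 d) :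
    |jacDet P x| ≤ d.factorial := by
  simpa using abs_jacDet_le hP x

theorem abs_jacDet_update_le (hP : ∀ k, LipschitzWith 1 (P k)) {b : ℝ} {x : 𝔼 d}
    (hw : ∀ l, |fderiv ℝ w x (EuclideanSpace.single l 1)| ≤ b) :
    |jacDet (Function.update P j w) x| ≤ d.factorial * b := by
  have hrows (k l : Fin d) : |gradMat (Function.update P j w) x k l| ≤
      Function.update (fun _ => (1 : ℝ)) j b k := by
    rcases eq_or_ne k j with rfl | hk
    · simpa [gradMat] using hw l
    · simpa [gradMat, hk] using abs_fderiv_single_le (hP k) x l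
  simpa [jacDet, Finset.prod_update_of_mem] using abs_det_le hrows

theorem ae_abs_fderiv_mul_le (hr : LipschitzWith ρ r) (hr1 : ∀ x, |r x| ≤ 1)
    (hg : LipschitzWith L g) :
    ∀ᵐ x, ∀ l, |fderiv ℝ (fun y => r y * g y) x (EuclideanSpace.single l 1)| ≤ ρ * |g x| + L := by
  filter_upwards [hr.ae_differentiableAt, hg.ae_differentiableAt] with x hrx hgx l
  rw [fderiv_fun_mul hrx hgx]
  calc |r x * fderiv ℝ g x (EuclideanSpace.single l 1) +
        g x * fderiv ℝ r x (EuclideanSpace.single l 1)|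
      ≤ |r x| * |fderiv ℝ g x (EuclideanSpace.single l 1)| +
          |g x| * |fderiv ℝ r x (EuclideanSpace.single l 1)| := by
        rw [← abs_mul, ← abs_mul]; exact abs_add_le _ _
    _ ≤ 1 * L + |g x| * ρ := by
        gcongr
        exacts [hr1 x, abs_fderiv_single_le hg x l, abs_fderiv_single_le hr x l]
    _ = ρ * |g x| + L := by ring

theorem LipSupp.integral_mul_jacDet_update (hw : LipSupp C R w)
    (hP : ∀ k, LipschitzWith K (P k)) (hφ : LipschitzWith K φ) (j : Fin d) :
    ∫ x, w x * jacDet (Function.update P j φ) x =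
      -∫ x, φ x * jacDet (Function.update P j w) x := by
  simpa using integral_mul_jacDet (p := Function.update P j φ) hw
    (fun k => (lipschitzWith_update hP hφ k).weaken (max_self K).le) j

theorem LipSupp.integral_mul_jacDet_update_sub (hw : LipSupp C R w)
    (hP : ∀ k, LipschitzWith K (P k)) (hφ : LipschitzWith K φ) (hψ : LipschitzWith K ψ)
    (j : Fin d) :
    (∫ x, w x * jacDet (Function.update P j φ) x) - ∫ x, w x * jacDet (Function.update P j ψ) x =
      -∫ x, (φ x - ψ x) * jacDet (Function.update P j w) x := by
  simp_rw [sub_mul]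
  rw [hw.integral_mul_jacDet_update hP hφ, hw.integral_mul_jacDet_update hP hψ,
    integral_sub (hw.integrable_mul_jacDet_update hP hφ.continuous j)
      (hw.integrable_mul_jacDet_update hP hψ.continuous j)]
  ring

theorem LipSupp.abs_integral_diffQuot_mul_jacDet_update_le (hw : LipSupp C R w)
    (hP : ∀ k, LipschitzWith 1 (P k)) (hφ : LipschitzWith 1 φ) (i j : Fin d) (hh : 0 < h) :
    |∫ x, diffQuot i h φ x * jacDet (Function.update P j w) x| ≤
      d.factorial * (2 / h) * ∫ x, |w x| := by
  let K : ℝ≥0 := ‖h⁻¹‖₊ * (1 + 1)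
  have hδ : LipschitzWith K (diffQuot i h φ) := lipschitzWith_diffQuot hφ i h
  have hK : (K : ℝ) = 2 / h := by
    simp [K, abs_of_pos hh]; ring
  have hibp := hw.integral_mul_jacDet_update (K := max K 1)
    (fun k => (hP k).weaken (le_max_right _ _)) (hδ.weaken (le_max_left _ _)) j
  rw [← abs_neg, ← hibp, ← integral_const_mul, ← Real.norm_eq_abs]
  refine norm_integral_le_of_norm_le (hw.integrable.abs.const_mul _)
    (Eventually.of_forall fun x => ?_)
  have hdet := abs_jacDet_update_le (j := j) hP (abs_fderiv_single_le hδ x)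
  rw [norm_mul, mul_comm]
  exact mul_le_mul_of_nonneg_right (hK ▸ hdet) (abs_nonneg _)

theorem abs_integral_mul_jacDet_update_mul_le (hP : ∀ k, LipschitzWith 1 (P k))
    (hr : LipschitzWith ρ r) (hr1 : ∀ x, |r x| ≤ 1) (hg : LipSupp L R g) (hv : Continuous v)
    (hgv : ∀ x, |g x| ≤ v x) (hf : Continuous f) (j : Fin d) :
    |∫ x, f x * jacDet (Function.update P j fun y => r y * g y) x| ≤
      d.factorial * ∫ x in Metric.closedBall 0 R, |f x| * (ρ * v x + L) := by
  have hzero (x : 𝔼 d) (hx : x ∉ Metric.closedBall 0 R) :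
      f x * jacDet (Function.update P j fun y => r y * g y) x = 0 := by
    rw [jacDet_eq_zero_of_norm_gt (j := j) (R := R) (fun y hy => ?_) (by simpa using hx), mul_zero]
    rw [Function.update_self, hg.zero y hy, mul_zero]
  have hint : IntegrableOn (fun x => |f x| * (ρ * v x + L)) (Metric.closedBall 0 R) :=
    ContinuousOn.integrableOn_compact (isCompact_closedBall 0 R) (by fun_prop)
  rw [← setIntegral_eq_integral_of_forall_compl_eq_zero hzero, ← integral_const_mul,
    ← Real.norm_eq_abs]
  refine norm_integral_le_of_norm_le (hint.const_mul _) (ae_restrict_of_ae ?_)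
  filter_upwards [ae_abs_fderiv_mul_le hr hr1 hg.lip] with x hx
  calc ‖f x * jacDet (Function.update P j fun y => r y * g y) x‖
      ≤ |f x| * (d.factorial * (ρ * |g x| + L)) := by
        rw [norm_mul]
        exact mul_le_mul_of_nonneg_left (abs_jacDet_update_le hP hx) (abs_nonneg _)
    _ ≤ |f x| * (d.factorial * (ρ * v x + L)) := by
        gcongr
        exact hgv x
    _ = d.factorial * (|f x| * (ρ * v x + L)) := by ring

-- Young's inequality `|f| ≤ s f² / 2 + 1 / (2 s)`.
theorem setIntegral_abs_mul_le {S : Set (𝔼 d)} (hf : Continuous f) (hv : Continuous v)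
    (hv0 : ∀ x, 0 ≤ v x) (hS : IsCompact S) (hfv : Integrable fun x => f x ^ 2 * v x) {s : ℝ}
    (hs : 0 < s) :
    ∫ x in S, |f x| * v x ≤ s / 2 * (∫ x, f x ^ 2 * v x) + (∫ x in S, v x) / (2 * s) := by
  have hvS : IntegrableOn v S := hv.continuousOn.integrableOn_compact hS
  have hyoung (x : 𝔼 d) : |f x| * v x ≤ s / 2 * (f x ^ 2 * v x) + (2 * s)⁻¹ * v x := by
    have hsq : |f x| ≤ s / 2 * f x ^ 2 + (2 * s)⁻¹ := by
      have h0 : 0 ≤ (2 * s)⁻¹ * (s * |f x| - 1) ^ 2 := by positivity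
      rw [← sq_abs (f x)]
      field_simp at h0 ⊢
      linarith
    nlinarith [mul_le_mul_of_nonneg_right hsq (hv0 x)]
  calc ∫ x in S, |f x| * v x
      ≤ ∫ x in S, (s / 2 * (f x ^ 2 * v x) + (2 * s)⁻¹ * v x) :=
        setIntegral_mono (ContinuousOn.integrableOn_compact hS (by fun_prop))
          (ContinuousOn.integrableOn_compact hS (by fun_prop)) hyoung
    _ = s / 2 * (∫ x in S, f x ^ 2 * v x) + (∫ x in S, v x) / (2 * s) := by
        rw [integral_add (hfv.integrableOn.const_mul _) (hvS.const_mul _), integral_const_mul,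
          integral_const_mul, inv_mul_eq_div]
    _ ≤ s / 2 * (∫ x, f x ^ 2 * v x) + (∫ x in S, v x) / (2 * s) := by
        gcongr
        exacts [Eventually.of_forall fun x => mul_nonneg (sq_nonneg _) (hv0 x),
          Measure.restrict_le_self]

theorem mul_abs_integral_mul_jacDet_update_mul_le (hP : ∀ k, LipschitzWith 1 (P k))
    (hr : LipschitzWith ρ r) (hr1 : ∀ x, |r x| ≤ 1) (hh : 0 ≤ h) (hρ : h * ρ = Real.pi)
    (hg : LipSupp L R g) (hv : Continuous v) (hgv : ∀ x, |g x| ≤ v x)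
    (hV : ∫ x in Metric.closedBall 0 R, v x ≤ V) (hf : Continuous f) (hf2 : ∀ x, |f x| ≤ 2)
    (hfv : Integrable fun x => f x ^ 2 * v x) {D : ℝ} (hD : ∫ x, f x ^ 2 * v x ≤ D)
    {s : ℝ} (hs : 0 < s) (j : Fin d) :
    h * |∫ x, f x * jacDet (Function.update P j fun y => r y * g y) x| ≤
      d.factorial * (2 * s * D + 2 * V / s +
        2 * (h * L) * volume.real (Metric.closedBall (0 : 𝔼 d) R)) := by
  let S : Set (𝔼 d) := Metric.closedBall 0 R
  have hS : IsCompact S := isCompact_closedBall 0 R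
  have hv0 (x : 𝔼 d) : 0 ≤ v x := (abs_nonneg _).trans (hgv x)
  have hweighted : ∫ x in S, |f x| * v x ≤ s / 2 * D + V / (2 * s) := by
    refine (setIntegral_abs_mul_le hf hv hv0 hS hfv hs).trans ?_
    gcongr
  have habs : ∫ x in S, |f x| ≤ 2 * volume.real S := by
    refine (Real.le_norm_self _).trans (norm_setIntegral_le_of_norm_le_const hS.measure_lt_top
      fun x _ => ?_)
    rw [norm_abs_eq_norm]
    exact hf2 x
  have hsplit : h * ∫ x in S, |f x| * (ρ * v x + L) =
      Real.pi * (∫ x in S, |f x| * v x) + h * L * ∫ x in S, |f x| := by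
    have hexpand (x : 𝔼 d) : |f x| * (ρ * v x + L) = ρ * (|f x| * v x) + L * |f x| := by ring
    simp_rw [hexpand]
    rw [integral_add (ContinuousOn.integrableOn_compact hS (by fun_prop))
      (ContinuousOn.integrableOn_compact hS (by fun_prop)), integral_const_mul,
      integral_const_mul, ← hρ]
    ring
  have hnn : 0 ≤ ∫ x in S, |f x| * v x := integral_nonneg fun x => mul_nonneg (abs_nonneg _) (hv0 x)
  calc h * |∫ x, f x * jacDet (Function.update P j fun y => r y * g y) x|
      ≤ h * (d.factorial * ∫ x in S, |f x| * (ρ * v x + L)) :=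
        mul_le_mul_of_nonneg_left
          (abs_integral_mul_jacDet_update_mul_le hP hr hr1 hg hv hgv hf j) hh
    _ = d.factorial * (Real.pi * (∫ x in S, |f x| * v x) + h * L * ∫ x in S, |f x|) := by
        rw [← hsplit]; ring
    _ ≤ d.factorial * (4 * (s / 2 * D + V / (2 * s)) + h * L * (2 * volume.real S)) := by
        gcongr
        exact Real.pi_le_four
    _ = _ := by simp only [S]; ring

theorem LipSupp.integral_abs_mul_le (hg : LipSupp L R g) (hr : LipschitzWith ρ r)
    (hr1 : ∀ x, |r x| ≤ 1) (hv : Continuous v) (hgv : ∀ x, |g x| ≤ v x) :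
    ∫ x, |r x * g x| ≤ ∫ x in Metric.closedBall 0 R, v x := by
  obtain ⟨C, hw⟩ := hg.mul_lipschitz hr
  rw [← setIntegral_eq_integral_of_forall_compl_eq_zero (s := Metric.closedBall 0 R)
    fun x hx => by rw [hw.zero x (by simpa using hx), abs_zero]]
  refine setIntegral_mono hw.integrable.abs.integrableOn
    (hv.continuousOn.integrableOn_compact (isCompact_closedBall 0 R)) fun x => ?_
  rw [abs_mul]
  exact (mul_le_of_le_one_left (abs_nonneg _) (hr1 x)).trans (hgv x)

theorem mul_abs_integral_diffQuot_sub_mul_jacDet_update_le (hP : ∀ k, LipschitzWith 1 (P k))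
    (hr : LipschitzWith ρ r) (hr1 : ∀ x, |r x| ≤ 1) (hh : 0 ≤ h) (hρ : h * ρ = Real.pi)
    (hg : LipSupp L R g) (hv : Continuous v) (hgv : ∀ x, |g x| ≤ v x)
    (hV : ∫ x in Metric.closedBall 0 R, v x ≤ V) (hφ : LipSupp 1 R φ) {s t D : ℝ} (hs : 0 < s)
    (hD : ∫ x, (diffQuot i h φ x - diffQuot i t φ x) ^ 2 * v x ≤ D) (j : Fin d) :
    h * |∫ x, (diffQuot i h φ x - diffQuot i t φ x) *
        jacDet (Function.update P j fun y => r y * g y) x| ≤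
      d.factorial * (2 * s * D + 2 * V / s +
        2 * (h * L) * volume.real (Metric.closedBall (0 : 𝔼 d) R)) := by
  have hδ (t : ℝ) : Continuous (diffQuot i t φ) := continuous_diffQuot hφ.lip.continuous i t
  have hbound (x : 𝔼 d) : |diffQuot i h φ x - diffQuot i t φ x| ≤ 2 := by
    have h1 := abs_diffQuot_le hφ.lip i h x
    have h2 := abs_diffQuot_le hφ.lip i t x
    rw [NNReal.coe_one] at h1 h2
    linarith [abs_sub (diffQuot i h φ x) (diffQuot i t φ x)]
  exact mul_abs_integral_mul_jacDet_update_mul_le hP hr hr1 hh hρ hg hv hgv hV ((hδ h).sub (hδ t))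
    hbound (integrable_diffQuot_sub_sq_mul hφ.lip.continuous hφ.hasCompactSupport hv i _ _) hD hs j

theorem LipSupp.abs_integral_jacDet_update_translate_sub_le (hP : ∀ k, LipschitzWith 1 (P k))
    (hr : LipschitzWith ρ r) (hr1 : ∀ x, |r x| ≤ 1) (hh : 0 < h) (hρ : h * ρ = Real.pi)
    (hg : LipSupp L R g) (hv : Continuous v) (hgv : ∀ x, |g x| ≤ v x)
    (hV : ∫ x in Metric.closedBall 0 R, v x ≤ V) (hφ : LipSupp 1 R φ) {s D : ℝ} (hs : 0 < s)
    (hD : ∫ x, (diffQuot i h φ x - diffQuot i (s * h) φ x) ^ 2 * v x ≤ D) (j : Fin d) :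
    |(∫ x, r x * g x *
          jacDet (Function.update P j fun y => φ (y + EuclideanSpace.single i h)) x) -
        ∫ x, r x * g x * jacDet (Function.update P j φ) x| ≤
      d.factorial * (2 * s * D + 4 * V / s +
        2 * (h * L) * volume.real (Metric.closedBall (0 : 𝔼 d) R)) := by
  obtain ⟨C, hw⟩ := hg.mul_lipschitz hr
  let J : 𝔼 d → ℝ := jacDet (Function.update P j fun y => r y * g y)
  let δ (t : ℝ) : 𝔼 d → ℝ := diffQuot i t φ
  have hδ (t : ℝ) : Continuous (δ t) := continuous_diffQuot hφ.lip.continuous i t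
  have hint (t : ℝ) : Integrable fun x => δ t x * J x :=
    hw.integrable_mul_jacDet_update hP (hδ t) j
  have hL1 : ∫ x, |r x * g x| ≤ V := (hg.integral_abs_mul_le hr hr1 hv hgv).trans hV
  have hlow : h * |∫ x, δ (s * h) x * J x| ≤ d.factorial * (2 * V / s) := by
    calc h * |∫ x, δ (s * h) x * J x|
        ≤ h * (d.factorial * (2 / (s * h)) * ∫ x, |r x * g x|) := by
          gcongr
          exact hw.abs_integral_diffQuot_mul_jacDet_update_le hP hφ.lip i j (by positivity)
      _ ≤ h * (d.factorial * (2 / (s * h)) * V) := by gcongr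
      _ = d.factorial * (2 * V / s) := by field_simp
  have hhigh := mul_abs_integral_diffQuot_sub_mul_jacDet_update_le hP hr hr1 hh.le hρ hg hv hgv hV
    hφ hs hD j
  have hquot (x : 𝔼 d) : φ (x + EuclideanSpace.single i h) - φ x = h * δ h x := by
    simp only [δ, diffQuot]
    field_simp
  rw [hw.integral_mul_jacDet_update_sub hP (lipschitzWith_comp_add_right hφ.lip _) hφ.lip, abs_neg]
  calc |∫ x, (φ (x + EuclideanSpace.single i h) - φ x) * J x|
      = h * |(∫ x, (δ h x - δ (s * h) x) * J x) + ∫ x, δ (s * h) x * J x| := by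
        simp_rw [hquot, sub_mul, mul_assoc]
        rw [integral_sub (hint h) (hint _), sub_add_cancel, integral_const_mul, abs_mul,
          abs_of_pos hh]
    _ ≤ h * |∫ x, (δ h x - δ (s * h) x) * J x| + h * |∫ x, δ (s * h) x * J x| := by
        rw [← mul_add]
        exact mul_le_mul_of_nonneg_left (abs_add_le _ _) hh.le
    _ ≤ d.factorial * (2 * s * D + 2 * V / s +
          2 * (h * L) * volume.real (Metric.closedBall (0 : 𝔼 d) R)) +
          d.factorial * (2 * V / s) := add_le_add hhigh hlow
    _ = _ := by ring

theorem abs_sub_le_card_mul_of_update {ι α : Type*} [Fintype ι] [DecidableEq ι]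
    {Φ : (ι → α) → ℝ} {p q : ι → α} {D : ℝ}
    (hD : ∀ (P : ι → α) (j : ι), (∀ k, P k = p k ∨ P k = q k) →
      |Φ (Function.update P j (q j)) - Φ (Function.update P j (p j))| ≤ D) :
    |Φ q - Φ p| ≤ Fintype.card ι * D := by
  have key (s : Finset ι) : |Φ (s.piecewise q p) - Φ p| ≤ s.card * D := by
    induction s using Finset.induction_on with
    | empty => simp
    | insert j s hj ih =>
      have hself : Function.update (s.piecewise q p) j (p j) = s.piecewise q p :=
        Function.update_eq_self_iff.2 (s.piecewise_eq_of_notMem q p hj).symm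
      have hstep := hD (s.piecewise q p) j fun k =>
        (s.piecewise_cases q p (fun y => y = p k ∨ y = q k) (Or.inr rfl) (Or.inl rfl))
      rw [hself, ← Finset.piecewise_insert] at hstep
      rw [Finset.card_insert_of_notMem hj, Nat.cast_succ, add_one_mul, add_comm]
      exact (abs_sub_le _ _ _).trans (add_le_add hstep ih)
  simpa using key Finset.univ

theorem integrable_mul_jacDet_comp_add_right (hw : LipSupp C R w)
    (hp : ∀ k, LipschitzWith K (p k)) (a : 𝔼 d) :
    Integrable fun x => w x * jacDet p (x + a) := by
  simpa only [jacDet_comp_add_right] using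
    hw.integrable_mul_jacDet fun k => lipschitzWith_comp_add_right (hp k) a

-- Translate half of the integral by a half period of `r`, which changes the sign of `r`.
theorem two_mul_integral_antiperiodic_mul_jacDet (hw : LipSupp C R g) (hr : LipschitzWith ρ r)
    {a : 𝔼 d} (hra : ∀ x, r (x + a) = -r x) (hp : ∀ k, LipschitzWith K (p k)) :
    2 * ∫ x, r x * g x * jacDet p x =
      ((∫ x, r x * g x * jacDet p x) - ∫ x, r x * g x * jacDet (fun k y => p k (y + a)) x) -
        ∫ x, r x * (g (x + a) - g x) * jacDet p (x + a) := by
  obtain ⟨C', hrg⟩ := hw.mul_lipschitz hr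
  have hint := hrg.integrable_mul_jacDet hp
  have hint' := integrable_mul_jacDet_comp_add_right hrg hp a
  have hflip (x : 𝔼 d) : r x * (g (x + a) - g x) * jacDet p (x + a) =
      -(r (x + a) * g (x + a) * jacDet p (x + a)) - r x * g x * jacDet p (x + a) := by
    rw [hra]; ring
  simp_rw [jacDet_comp_add_right, hflip]
  rw [integral_sub (by exact (hint.comp_add_right a).neg) hint', integral_neg,
    integral_add_right_eq_self fun x => r x * g x * jacDet p x]
  ring

theorem abs_integral_mul_sub_translate_mul_jacDet_le (hg : LipSupp L R g) (hr1 : ∀ x, |r x| ≤ 1)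
    (hh : 0 ≤ h) (hh1 : h ≤ 1) (hp : ∀ k, LipschitzWith 1 (p k)) :
    |∫ x, r x * (g (x + EuclideanSpace.single i h) - g x) *
        jacDet p (x + EuclideanSpace.single i h)| ≤
      d.factorial * (h * L) * volume.real (Metric.closedBall (0 : 𝔼 d) (R + 1)) := by
  rw [← setIntegral_eq_integral_of_forall_compl_eq_zero (s := Metric.closedBall 0 (R + 1)),
    ← Real.norm_eq_abs]
  · refine norm_setIntegral_le_of_norm_le_const measure_closedBall_lt_top fun x _ => ?_
    have hdist := hg.lip.dist_le_mul (x + EuclideanSpace.single i h) x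
    rw [Real.dist_eq, dist_self_add_left, PiLp.norm_single, Real.norm_of_nonneg hh] at hdist
    calc ‖r x * (g (x + EuclideanSpace.single i h) - g x) * jacDet p _‖
        ≤ 1 * (L * h) * d.factorial := by
          rw [norm_mul, norm_mul]
          gcongr
          exacts [hr1 x, hdist, abs_jacDet_le_of_lipschitzWith_one hp _]
      _ = d.factorial * (h * L) := by ring
  · intro x hx
    have hx' : R + 1 < ‖x‖ := by simpa using hx
    rw [eq_zero_add_single_of_norm_gt hg.zero (by rw [abs_of_nonneg hh]; linarith),
      hg.zero x (by linarith), sub_zero, mul_zero, zero_mul]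

theorem abs_integral_antiperiodic_mul_jacDet_le (hr : LipschitzWith ρ r) (hr1 : ∀ x, |r x| ≤ 1)
    (hra : ∀ x, r (x + EuclideanSpace.single i h) = -r x) (hh : 0 < h) (hh1 : h ≤ 1)
    (hρ : h * ρ = Real.pi) (hg : LipSupp L R g) (hv : Continuous v) (hgv : ∀ x, |g x| ≤ v x)
    (hV : ∫ x in Metric.closedBall 0 R, v x ≤ V) (hp : ∀ k, LipSupp 1 R (p k)) {s D : ℝ}
    (hs : 0 < s)
    (hD : ∀ k, ∫ x, (diffQuot i h (p k) x - diffQuot i (s * h) (p k) x) ^ 2 * v x ≤ D) :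
    2 * |∫ x, r x * g x * jacDet p x| ≤
      d * (d.factorial * (2 * s * D + 4 * V / s +
        2 * (h * L) * volume.real (Metric.closedBall (0 : 𝔼 d) R))) +
      d.factorial * (h * L) * volume.real (Metric.closedBall (0 : 𝔼 d) (R + 1)) := by
  have htranslate (k : Fin d) : LipschitzWith 1 fun y => p k (y + EuclideanSpace.single i h) :=
    lipschitzWith_comp_add_right (hp k).lip _
  have hrows := abs_sub_le_card_mul_of_update (p := p)
    (q := fun k y => p k (y + EuclideanSpace.single i h))
    (Φ := fun P => ∫ x, r x * g x * jacDet P x) fun P j hP =>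
      hg.abs_integral_jacDet_update_translate_sub_le
        (fun k => (hP k).elim (fun h => h ▸ (hp k).lip) fun h => h ▸ htranslate k)
        hr hr1 hh hρ hv hgv hV (hp j) hs (hD j) j
  rw [abs_sub_comm, Fintype.card_fin] at hrows
  rw [← abs_two (α := ℝ), ← abs_mul, abs_two,
    two_mul_integral_antiperiodic_mul_jacDet hg hr hra fun k => (hp k).lip]
  exact (abs_sub _ _).trans (add_le_add hrows
    (abs_integral_mul_sub_translate_mul_jacDet_le hg hr1 hh.le hh1 fun k => (hp k).lip))

/-- A plane wave oscillating in direction `i` with half period `h`. -/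
noncomputable def wave (i : Fin d) (h : ℝ) (x : 𝔼 d) : ℝ :=
  Real.cos (Real.pi / h * x i)

theorem abs_wave_le_one (i : Fin d) (h : ℝ) (x : 𝔼 d) : |wave i h x| ≤ 1 :=
  Real.abs_cos_le_one _

theorem lipschitzWith_wave (i : Fin d) (h : ℝ) : LipschitzWith ‖Real.pi / h‖₊ (wave i h) := by
  have hcos := Real.lipschitzWith_cos.comp
    ((lipschitzWith_smul (Real.pi / h)).comp (lipschitzWith_coord i))
  rw [one_mul, mul_one] at hcos
  exact hcos

theorem wave_add_single (hh : h ≠ 0) (i : Fin d) (x : 𝔼 d) :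
    wave i h (x + EuclideanSpace.single i h) = -wave i h x := by
  simp [wave, mul_add, div_mul_cancel₀ _ hh]

/-- The gain from oscillation at half period `h`: modulo an error `η`, the pairing of a wave with a
Jacobian is controlled by the drop of the energy between the scales `h` and `2 ^ m * h`. Here `g` is
the amplitude of the wave, `v` a weight dominating it, and `V` bounds the mass of the weight. -/
def OscillationBound (i : Fin d) (R V η : ℝ) (m : ℕ) (B δ : ℝ) : Prop :=
  ∀ ⦃h : ℝ⦄ ⦃L : ℝ≥0⦄ ⦃g v : 𝔼 d → ℝ⦄ ⦃p : Fin d → 𝔼 d → ℝ⦄, 0 < h → h ≤ 1 → h * L ≤ δ →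
    LipSupp L R g → Continuous v → (∀ x, |g x| ≤ v x) →
    (∀ x t, v (x + EuclideanSpace.single i t) = v x) →
    ∫ x in Metric.closedBall 0 R, v x ≤ V → (∀ k, LipSupp 1 R (p k)) →
    |∫ x, wave i h x * g x * jacDet p x| ≤
      η + B * (energy i h v p - energy i (2 ^ m * h) v p)

theorem exists_oscillationBound (i : Fin d) (R V : ℝ) {η : ℝ} (hη : 0 < η) :
    ∃ (m : ℕ) (B δ : ℝ), 0 ≤ B ∧ 0 < δ ∧ OscillationBound i R V η m B δ := by
  let Ω : ℝ := d.factorial * (2 * d * volume.real (Metric.closedBall (0 : 𝔼 d) R) +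
    volume.real (Metric.closedBall (0 : 𝔼 d) (R + 1)))
  have hΩ : 0 < Ω + 1 := by positivity
  obtain ⟨m, hm⟩ := pow_unbounded_of_one_lt (4 * d * d.factorial * V / η) one_lt_two
  refine ⟨m, d * d.factorial * 2 ^ m * m, η / (Ω + 1), by positivity, div_pos hη hΩ, ?_⟩
  intro h L g v p hh hh1 hL hg hv hgv hinv hV hp
  have hmain := abs_integral_antiperiodic_mul_jacDet_le (lipschitzWith_wave i h)
    (abs_wave_le_one i h) (wave_add_single hh.ne' i) hh hh1
    (by simp [abs_of_pos hh, abs_of_pos Real.pi_pos, mul_div_cancel₀ _ hh.ne']) hg hv hgv hV hp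
    (pow_pos two_pos m) (integral_diffQuot_sub_two_pow_mul_sq_le_energy
      (fun k => (hp k).lip.continuous) (fun k => (hp k).hasCompactSupport) hv
      (fun x => (abs_nonneg _).trans (hgv x)) hinv m)
  have hmass : d * d.factorial * (4 * V / 2 ^ m) ≤ η := by
    rw [div_lt_iff₀ hη] at hm
    rw [mul_div_assoc', div_le_iff₀ (by positivity)]
    linarith
  have hosc : h * L * Ω ≤ η := by
    rw [le_div_iff₀ hΩ] at hL
    nlinarith [mul_nonneg hh.le L.coe_nonneg]
  simp only [Ω] at hosc
  linarith

end Oscillation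

section BoundedLipschitz

/-- `f` is Lipschitz and bounded, both with the same constant `K`. The common constant makes the
class closed under products with control of the constants. -/
structure BddLip (K : ℝ≥0) (f : 𝔼 d → ℝ) : Prop where
  lip : LipschitzWith K f
  abs_le : ∀ x, |f x| ≤ K

variable {C K K' : ℝ≥0} {R : ℝ} {f g : 𝔼 d → ℝ}

namespace BddLip

theorem lipSupp (hf : BddLip K f) (h0 : ∀ x, R < ‖x‖ → f x = 0) : LipSupp K R f :=
  ⟨hf.lip, h0⟩

theorem const (c : ℝ) : BddLip ‖c‖₊ fun _ : 𝔼 d => c :=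
  ⟨LipschitzWith.const' c, fun _ => by simp⟩

theorem add (hf : BddLip K f) (hg : BddLip K' g) : BddLip (K + K') fun x => f x + g x :=
  ⟨hf.lip.add hg.lip, fun x =>
    (abs_add_le _ _).trans (by push_cast; exact add_le_add (hf.abs_le x) (hg.abs_le x))⟩

theorem mul (hf : BddLip K f) (hg : BddLip K' g) :
    BddLip (2 * (K * K')) fun x => f x * g x := by
  refine ⟨LipschitzWith.of_dist_le_mul fun x y => ?_, fun x => ?_⟩
  · have hfx : |f x * (g x - g y)| ≤ K * (K' * dist x y) := by
      rw [abs_mul]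
      exact mul_le_mul (hf.abs_le x) (hg.lip.dist_le_mul x y) (abs_nonneg _) K.coe_nonneg
    have hgy : |(f x - f y) * g y| ≤ K * dist x y * K' := by
      rw [abs_mul]
      exact mul_le_mul (hf.lip.dist_le_mul x y) (hg.abs_le y) (abs_nonneg _) (by positivity)
    calc dist (f x * g x) (f y * g y) = |f x * (g x - g y) + (f x - f y) * g y| := by
          rw [Real.dist_eq]; ring_nf
      _ ≤ K * (K' * dist x y) + K * dist x y * K' := (abs_add_le _ _).trans (add_le_add hfx hgy)
      _ = ↑(2 * (K * K')) * dist x y := by push_cast; ring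
  · rw [abs_mul]
    push_cast
    linarith [mul_le_mul (hf.abs_le x) (hg.abs_le x) (abs_nonneg _) K.coe_nonneg,
      mul_nonneg K.coe_nonneg K'.coe_nonneg]

theorem sq (hf : BddLip K f) : BddLip (2 * (K * K)) fun x => f x ^ 2 := by
  simpa only [pow_two] using hf.mul hf

end BddLip

theorem LipSupp.bddLip (hf : LipSupp K R f) (h1 : ∀ x, |f x| ≤ 1) : BddLip (K + 1) f :=
  ⟨hf.lip.weaken le_self_add, fun x => (h1 x).trans (by push_cast; linarith [K.coe_nonneg])⟩

theorem bddLip_diffQuot (hg : LipschitzWith C g) (i : Fin d) (h : ℝ) :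
    BddLip (‖h⁻¹‖₊ * (C + C) + C) (diffQuot i h g) :=
  ⟨(lipschitzWith_diffQuot hg i h).weaken le_self_add, fun x => (abs_diffQuot_le hg i h x).trans
    (by push_cast; exact le_add_of_nonneg_left (by positivity))⟩

theorem bddLip_wave (i : Fin d) (h : ℝ) : BddLip (‖Real.pi / h‖₊ + 1) (wave i h) :=
  ⟨(lipschitzWith_wave i h).weaken le_self_add, fun x => (abs_wave_le_one i h x).trans
    (by push_cast; exact le_add_of_nonneg_left (by positivity))⟩

end BoundedLipschitz

section Profiles

/-- The factor `π (sin (N x_j))⁺`, of mean `1`, by which the density is concentrated on strips. -/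
noncomputable def strips (j : Fin d) (N : ℝ) (x : 𝔼 d) : ℝ :=
  Real.pi * (Real.sin (N * x j))⁺

/-- The factor `(sin (N x_j))⁻`, of mean `1 / π`, supported in the gaps between the strips. -/
noncomputable def gaps (j : Fin d) (N : ℝ) (x : 𝔼 d) : ℝ :=
  (Real.sin (N * x j))⁻

variable {j : Fin d} {N : ℝ}

theorem strips_nonneg (j : Fin d) (N : ℝ) (x : 𝔼 d) : 0 ≤ strips j N x :=
  mul_nonneg Real.pi_pos.le (posPart_nonneg _)

theorem gaps_nonneg (j : Fin d) (N : ℝ) (x : 𝔼 d) : 0 ≤ gaps j N x :=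
  negPart_nonneg _

theorem gaps_le_one (j : Fin d) (N : ℝ) (x : 𝔼 d) : gaps j N x ≤ 1 := by
  rw [gaps, negPart_def]
  exact sup_le (neg_le.1 (Real.neg_one_le_sin _)) zero_le_one

theorem strips_mul_gaps (j : Fin d) (N : ℝ) (x : 𝔼 d) : strips j N x * gaps j N x = 0 := by
  rcases le_total 0 (Real.sin (N * x j)) with h | h
  · rw [gaps, negPart_eq_zero.2 h, mul_zero]
  · rw [strips, posPart_eq_zero.2 h, mul_zero, zero_mul]

theorem lipschitzWith_sin_mul_coord (j : Fin d) (N : ℝ) :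
    LipschitzWith ‖N‖₊ fun x : 𝔼 d => Real.sin (N * x j) := by
  simpa [Function.comp_def] using
    Real.lipschitzWith_sin.comp ((lipschitzWith_smul N).comp (lipschitzWith_coord j))

theorem bddLip_gaps (j : Fin d) (N : ℝ) : BddLip (‖N‖₊ + 1) (gaps j N) := by
  refine ⟨((lipschitzWith_negPart.comp (lipschitzWith_sin_mul_coord j N)).weaken ?_), fun x => ?_⟩
  · simp
  · rw [abs_of_nonneg (gaps_nonneg j N x)]
    exact (gaps_le_one j N x).trans (by simp)

theorem bddLip_one_sub_gaps (j : Fin d) (N : ℝ) : BddLip (‖N‖₊ + 1) fun x => 1 - gaps j N x := by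
  refine ⟨((LipschitzWith.const (1 : ℝ)).sub (bddLip_gaps j N).lip).weaken (by simp), fun x => ?_⟩
  rw [abs_of_nonneg (sub_nonneg.2 (gaps_le_one j N x))]
  exact (sub_le_self _ (gaps_nonneg j N x)).trans (by simp)

theorem bddLip_strips (j : Fin d) (N : ℝ) :
    BddLip (2 * (‖Real.pi‖₊ * (‖N‖₊ + 1))) (strips j N) := by
  refine (BddLip.const Real.pi).mul
    ⟨(lipschitzWith_posPart.comp (lipschitzWith_sin_mul_coord j N)).weaken ?_, fun x => ?_⟩
  · simp
  · rw [abs_of_nonneg (posPart_nonneg _), posPart_def]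
    exact (sup_le (Real.sin_le_one _) zero_le_one).trans (by simp)

theorem integral_posPart_sin : ∫ t in 0..2 * Real.pi, (Real.sin t)⁺ = 2 := by
  have hint (a b : ℝ) : IntervalIntegrable (fun t => (Real.sin t)⁺) volume a b :=
    (continuous_posPart.comp Real.continuous_sin).intervalIntegrable a b
  have hpos : ∫ t in 0..Real.pi, (Real.sin t)⁺ = ∫ t in 0..Real.pi, Real.sin t :=
    intervalIntegral.integral_congr fun t ht => by
      rw [Set.uIcc_of_le Real.pi_pos.le] at ht
      exact posPart_eq_self.2 (Real.sin_nonneg_of_mem_Icc ht)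
  have hneg : ∫ t in Real.pi..2 * Real.pi, (Real.sin t)⁺ = ∫ t in Real.pi..2 * Real.pi, 0 :=
    intervalIntegral.integral_congr fun t ht => by
      rw [Set.uIcc_of_le (by linarith [Real.pi_pos])] at ht
      refine posPart_eq_zero.2 ?_
      rw [← Real.sin_sub_two_pi]
      exact Real.sin_nonpos_of_nonpos_of_neg_pi_le (by linarith [ht.2]) (by linarith [ht.1])
  rw [← intervalIntegral.integral_add_adjacent_intervals (hint 0 Real.pi) (hint _ _), hpos, hneg,
    integral_sin, intervalIntegral.integral_zero]
  norm_num

theorem integral_negPart_sin : ∫ t in 0..2 * Real.pi, (Real.sin t)⁻ = 2 := by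
  have hshift (t : ℝ) : (Real.sin t)⁻ = (Real.sin (t + Real.pi))⁺ := by
    rw [Real.sin_add_pi, posPart_neg]
  have hper : Function.Periodic (fun t => (Real.sin t)⁺) (2 * Real.pi) := fun t => by
    simp only [Real.sin_add_two_pi]
  simp_rw [hshift]
  rw [intervalIntegral.integral_comp_add_right fun t => (Real.sin t)⁺, zero_add,
    add_comm (2 * Real.pi), hper.intervalIntegral_add_eq Real.pi 0, zero_add, integral_posPart_sin]

variable {L : ℝ≥0} {R h : ℝ} {i : Fin d} {G v : 𝔼 d → ℝ}

theorem integral_pi_mul_posPart_sin :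
    ∫ t in 0..2 * Real.pi, Real.pi * (Real.sin t)⁺ = 2 * Real.pi * 1 := by
  rw [intervalIntegral.integral_const_mul, integral_posPart_sin]
  ring

theorem periodic_pi_mul_posPart_sin :
    Function.Periodic (fun t => Real.pi * (Real.sin t)⁺) (2 * Real.pi) := fun t => by
  simp only [Real.sin_add_two_pi]

theorem LipSupp.tendsto_integral_strips_mul (hG : LipSupp L R G) (j : Fin d) :
    Tendsto (fun N => ∫ x, strips j N x * G x) atTop (𝓝 (∫ x, G x)) := by
  simpa [strips] using hG.tendsto_integral_periodic_mul (by fun_prop) periodic_pi_mul_posPart_sin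
    (by positivity) integral_pi_mul_posPart_sin j

theorem LipSupp.tendsto_integral_gaps_mul (hG : LipSupp L R G) (j : Fin d) :
    Tendsto (fun N => ∫ x, gaps j N x * G x) atTop (𝓝 (Real.pi⁻¹ * ∫ x, G x)) :=
  hG.tendsto_integral_periodic_mul (φ := fun t => (Real.sin t)⁻) (by fun_prop)
    (fun t => by simp only [Real.sin_add_two_pi]) (c := 2 * Real.pi) (by positivity)
    (by rw [integral_negPart_sin]; field_simp) j

theorem tendsto_pi_div_half_pow : Tendsto (fun n : ℕ => Real.pi / 2⁻¹ ^ n) atTop atTop := by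
  simp_rw [inv_pow, div_inv_eq_mul]
  exact (tendsto_pow_atTop_atTop_of_one_lt one_lt_two).const_mul_atTop Real.pi_pos

theorem LipSupp.tendsto_integral_wave_mul (hG : LipSupp L R G) (i : Fin d) :
    Tendsto (fun n : ℕ => ∫ x, wave i (2⁻¹ ^ n) x * G x) atTop (𝓝 0) := by
  simpa [wave, Function.comp_def] using (hG.tendsto_integral_periodic_mul Real.continuous_cos
    Real.cos_periodic (m := 0) (by positivity) (by simp) i).comp tendsto_pi_div_half_pow

theorem LipSupp.tendsto_integral_wave_sq_mul (hG : LipSupp L R G) (i : Fin d) :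
    Tendsto (fun n : ℕ => ∫ x, wave i (2⁻¹ ^ n) x ^ 2 * G x) atTop (𝓝 (2⁻¹ * ∫ x, G x)) :=
  (hG.tendsto_integral_periodic_mul (φ := fun t => Real.cos t ^ 2) (by fun_prop)
    (fun t => by simp only [Real.cos_add_two_pi]) (c := 2 * Real.pi) (by positivity)
    (by rw [integral_cos_sq]; simp; ring) i).comp tendsto_pi_div_half_pow

theorem BddLip.lipSupp_diffQuot_sq_mul (hv : BddLip L v) (i : Fin d) (R h : ℝ) :
    ∃ K, ∀ g : 𝔼 d → ℝ, LipSupp 1 R g →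
      LipSupp K (R + |h|) fun x => diffQuot i h g x ^ 2 * v x :=
  ⟨_, fun _ hg => ((bddLip_diffQuot hg.lip i h).sq.mul hv).lipSupp fun _ hx => by
    rw [diffQuot_eq_zero hg.zero hx, zero_pow two_ne_zero, zero_mul]⟩

-- The choice of `N` is uniform in `p`, because `δ_h p_k` is `O(1/h)`-Lipschitz and `h` is fixed.
theorem BddLip.eventually_energy_le_energy_strips_mul_add (hv : BddLip L v) (i j : Fin d)
    (R : ℝ) {h η : ℝ} (hη : 0 < η) :
    ∀ᶠ N in atTop, ∀ p : Fin d → 𝔼 d → ℝ, (∀ k, LipSupp 1 R (p k)) →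
      energy i h v p ≤ energy i h (fun x => strips j N x * v x) p + η := by
  obtain ⟨K, hK⟩ := hv.lipSupp_diffQuot_sq_mul i R h
  obtain ⟨A, hA⟩ := exists_abs_integral_periodic_sub_mul_le (by fun_prop)
    periodic_pi_mul_posPart_sin (by positivity) integral_pi_mul_posPart_sin j K (R + |h|)
  have hN : ∀ᶠ N : ℝ in atTop, d * (A / N) < η := by
    have := (tendsto_const_nhds (x := A).div_atTop tendsto_id).const_mul (d : ℝ)
    rw [mul_zero] at this
    exact this.eventually_lt_const hη
  filter_upwards [hN, eventually_gt_atTop 0] with N hN hN0 p hp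
  have hterm (k : Fin d) : ∫ x, diffQuot i h (p k) x ^ 2 * v x ≤
      (∫ x, diffQuot i h (p k) x ^ 2 * (strips j N x * v x)) + A / N := by
    have hint : Integrable fun x => diffQuot i h (p k) x ^ 2 * (strips j N x * v x) :=
      integrable_diffQuot_sq_mul (hp k).lip.continuous (hp k).hasCompactSupport
        ((bddLip_strips j N).lip.continuous.mul hv.lip.continuous) i h
    have hdiff := hA N hN0 _ (hK _ (hp k))
    have heq (x : 𝔼 d) : (Real.pi * (Real.sin (N * x j))⁺ - 1) * (diffQuot i h (p k) x ^ 2 * v x) =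
        diffQuot i h (p k) x ^ 2 * (strips j N x * v x) - diffQuot i h (p k) x ^ 2 * v x := by
      rw [strips]; ring
    simp_rw [heq] at hdiff
    rw [integral_sub hint (hK _ (hp k)).integrable] at hdiff
    linarith [neg_le_of_abs_le hdiff]
  calc energy i h v p
      ≤ ∑ k, ((∫ x, diffQuot i h (p k) x ^ 2 * (strips j N x * v x)) + A / N) :=
        Finset.sum_le_sum fun k _ => hterm k
    _ = energy i h (fun x => strips j N x * v x) p + d * (A / N) := by
        simp [energy, Finset.sum_add_distrib]
    _ ≤ _ := by linarith

end Profiles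

section Construction

variable {i j : Fin d} {χ κ u v z X : 𝔼 d → ℝ} {R r Rκ V c η η' δ A B T h : ℝ} {m n : ℕ}
  {K Kκ : ℝ≥0}

/-- The state after `T` steps of the construction of a density `χ u` of large mass and small
pairings. The next summand of `u` oscillates in direction `i` with amplitude `v`. The function `X`,
with `|X| ≤ 1`, certifies the mass of `χ u`, and `z` is the room left for `X`, none of which is used
where `v ≠ 0`. Every step gains the mass `c / (2 π)` at the price `A` in the pairings; the energies
at the scale `2⁻ⁿ`, beyond which `u` does not oscillate, absorb the remaining errors. -/
structure IsStage (i : Fin d) (χ κ : 𝔼 d → ℝ) (R V c A B T : ℝ) (u v z X : 𝔼 d → ℝ) (n : ℕ) :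
    Prop where
  bddLip_u : ∃ K, BddLip K u
  bddLip_v : ∃ K, BddLip K v
  bddLip_z : ∃ K, BddLip K z
  bddLip_X : ∃ K, BddLip K X
  v_nonneg : ∀ x, 0 ≤ v x
  z_nonneg : ∀ x, 0 ≤ z x
  v_add_single : ∀ x t, v (x + EuclideanSpace.single i t) = v x
  v_mul_z : ∀ x, v x * z x = v x
  v_mul_X : ∀ x, v x * X x = 0
  abs_X_add_z_le : ∀ x, |X x| + z x ≤ 1
  integral_κ_lt : ∫ x, κ x * v x < V
  lt_integral_χ : c < ∫ x, χ x * v x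
  mass : c / (2 * Real.pi) * T ≤ ∫ x, χ x * (u x * X x)
  pairing : ∀ (f : 𝔼 d → ℝ) (p : Fin d → 𝔼 d → ℝ), BddLip 1 f → (∀ k, LipSupp 1 R (p k)) →
    |∫ x, χ x * u x * f x * jacDet p x| ≤ A * T + B * energy i (2⁻¹ ^ n) v p

theorem LipSupp.exists_mul_bddLip (hχ : LipSupp K R χ) (hv : ∃ K, BddLip K v) :
    ∃ K, LipSupp K R fun x => χ x * v x := by
  obtain ⟨_, hv⟩ := hv
  simp_rw [mul_comm (χ _)]
  exact hχ.mul_lipschitz hv.lip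

theorem setIntegral_closedBall_le_integral_mul (hκ : LipSupp Kκ Rκ κ) (hκ0 : ∀ x, 0 ≤ κ x)
    (hκ1 : ∀ x, ‖x‖ ≤ r → 1 ≤ κ x) (hv : ∃ K, BddLip K v) (hv0 : ∀ x, 0 ≤ v x) :
    ∫ x in Metric.closedBall 0 r, v x ≤ ∫ x, κ x * v x := by
  obtain ⟨_, hκv⟩ := hκ.exists_mul_bddLip hv
  obtain ⟨_, hv⟩ := hv
  calc ∫ x in Metric.closedBall 0 r, v x
      ≤ ∫ x in Metric.closedBall 0 r, κ x * v x :=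
        setIntegral_mono_on (hv.lip.continuous.continuousOn.integrableOn_compact
          (isCompact_closedBall 0 r)) hκv.integrable.integrableOn
          Metric.isClosed_closedBall.measurableSet fun x hx =>
            le_mul_of_one_le_left (hv0 x) (hκ1 x (by simpa using hx))
    _ ≤ ∫ x, κ x * v x := setIntegral_le_integral hκv.integrable
        (Eventually.of_forall fun x => mul_nonneg (hκ0 x) (hv0 x))

theorem energy_le_mul_integral_mul {p : Fin d → 𝔼 d → ℝ} (hh : |h| ≤ 1)
    (hp : ∀ k, LipSupp 1 R (p k)) (hκ : LipSupp Kκ Rκ κ) (hκ0 : ∀ x, 0 ≤ κ x)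
    (hκ1 : ∀ x, ‖x‖ ≤ R + 1 → 1 ≤ κ x) (hv : ∃ K, BddLip K v) (hv0 : ∀ x, 0 ≤ v x) :
    energy i h v p ≤ d * ∫ x, κ x * v x := by
  obtain ⟨_, hκv⟩ := hκ.exists_mul_bddLip hv
  obtain ⟨_, hv⟩ := hv
  have hterm (k : Fin d) : ∫ x, diffQuot i h (p k) x ^ 2 * v x ≤ ∫ x, κ x * v x := by
    refine integral_mono (integrable_diffQuot_sq_mul (hp k).lip.continuous
      (hp k).hasCompactSupport hv.lip.continuous i h) hκv.integrable fun x =>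
      mul_le_mul_of_nonneg_right ?_ (hv0 x)
    rcases le_or_gt ‖x‖ (R + 1) with hx | hx
    · refine le_trans ?_ (hκ1 x hx)
      rw [sq_le_one_iff_abs_le_one]
      exact abs_diffQuot_le (hp k).lip i h x
    · rw [diffQuot_eq_zero (hp k).zero (by linarith), zero_pow two_ne_zero]
      exact hκ0 x
  simpa [energy] using Finset.sum_le_sum fun k (_ : k ∈ Finset.univ) => hterm k

namespace IsStage

theorem zero (hA : 0 ≤ B) (hV : ∫ x, κ x < V) (hc : c < ∫ x, χ x) :
    IsStage i χ κ R V c A B 0 (fun _ => 0) (fun _ => 1) (fun _ => 1) (fun _ => 0) 0 where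
  bddLip_u := ⟨_, .const 0⟩
  bddLip_v := ⟨_, .const 1⟩
  bddLip_z := ⟨_, .const 1⟩
  bddLip_X := ⟨_, .const 0⟩
  v_nonneg _ := zero_le_one
  z_nonneg _ := zero_le_one
  v_add_single _ _ := rfl
  v_mul_z _ := mul_one _
  v_mul_X _ := mul_zero _
  abs_X_add_z_le _ := by simp
  integral_κ_lt := by simpa using hV
  lt_integral_χ := by simpa using hc
  mass := by simp
  pairing f p _ _ := by
    have : 0 ≤ energy i (2⁻¹ ^ 0) (fun _ => 1) p :=
      Finset.sum_nonneg fun k _ => integral_nonneg fun x => mul_nonneg (sq_nonneg _) zero_le_one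
    simpa using mul_nonneg hA this

theorem exists_lipSupp_χ_mul_v_mul (S : IsStage i χ κ R V c A B T u v z X n) (hχ : LipSupp K R χ)
    (hχ1 : ∀ x, |χ x| ≤ 1) :
    ∃ L, ∀ f : 𝔼 d → ℝ, BddLip 1 f → LipSupp L R fun x => χ x * v x * f x := by
  obtain ⟨_, hv⟩ := S.bddLip_v
  exact ⟨_, fun _ hf => (((hχ.bddLip hχ1).mul hv).mul hf).lipSupp fun x hx => by
    rw [hχ.zero x hx, zero_mul, zero_mul]⟩

theorem tendsto_integral_wave_mul (S : IsStage i χ κ R V c A B T u v z X n)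
    (hχ : LipSupp K R χ) :
    Tendsto (fun n' : ℕ => ∫ x, χ x * (wave i (2⁻¹ ^ n') x *
      (u x * z x + wave i (2⁻¹ ^ n') x * v x))) atTop (𝓝 (2⁻¹ * ∫ x, χ x * v x)) := by
  obtain ⟨_, hu⟩ := S.bddLip_u
  obtain ⟨_, hz⟩ := S.bddLip_z
  obtain ⟨_, huz⟩ := hχ.exists_mul_bddLip ⟨_, hu.mul hz⟩
  obtain ⟨_, hv⟩ := hχ.exists_mul_bddLip S.bddLip_v
  have hlim := (huz.tendsto_integral_wave_mul i).add (hv.tendsto_integral_wave_sq_mul i)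
  rw [zero_add] at hlim
  refine hlim.congr fun n' => ?_
  obtain ⟨_, hw⟩ := huz.mul_lipschitz (lipschitzWith_wave i (2⁻¹ ^ n'))
  obtain ⟨_, hw'⟩ := hv.mul_lipschitz (bddLip_wave i (2⁻¹ ^ n')).sq.lip
  rw [← integral_add hw.integrable hw'.integrable]
  congr 1 with x
  ring

-- Since `v X = 0` and `v z = v`, the only interaction of the new summands is on the gaps.
theorem integral_χ_mul_succ (S : IsStage i χ κ R V c A B T u v z X n) (hχ : LipSupp K R χ)
    (j : Fin d) (N h : ℝ) :
    ∫ x, χ x * ((u x + wave i h x * v x) * (X x + wave i h x * z x * gaps j N x)) =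
      (∫ x, χ x * (u x * X x)) +
        ∫ x, gaps j N x * (χ x * (wave i h x * (u x * z x + wave i h x * v x))) := by
  obtain ⟨_, hu⟩ := S.bddLip_u
  obtain ⟨_, hv⟩ := S.bddLip_v
  obtain ⟨_, hz⟩ := S.bddLip_z
  obtain ⟨_, hX⟩ := S.bddLip_X
  have hw := bddLip_wave i h
  obtain ⟨_, huX⟩ := hχ.exists_mul_bddLip ⟨_, hu.mul hX⟩
  obtain ⟨_, hgain⟩ := hχ.exists_mul_bddLip ⟨_, hw.mul ((hu.mul hz).add (hw.mul hv))⟩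
  obtain ⟨_, hgaps⟩ := hgain.mul_lipschitz (bddLip_gaps j N).lip
  rw [← integral_add huX.integrable hgaps.integrable]
  congr 1 with x
  linear_combination χ x * wave i h x * S.v_mul_X x +
    χ x * wave i h x ^ 2 * gaps j N x * S.v_mul_z x

theorem eventually_abs_integral_wave_mul_le (S : IsStage i χ κ R V c A B T u v z X n)
    (hχ : LipSupp K R χ) (hχ1 : ∀ x, |χ x| ≤ 1) (hκ : LipSupp Kκ Rκ κ) (hκ0 : ∀ x, 0 ≤ κ x)
    (hκ1 : ∀ x, ‖x‖ ≤ R → 1 ≤ κ x) (hB : 0 ≤ B) (hδ : 0 < δ)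
    (hosc : OscillationBound i R V η m B δ) :
    ∀ᶠ n' : ℕ in atTop, ∀ (f : 𝔼 d → ℝ) (p : Fin d → 𝔼 d → ℝ), BddLip 1 f →
      (∀ k, LipSupp 1 R (p k)) → |∫ x, wave i (2⁻¹ ^ n') x * (χ x * v x * f x) * jacDet p x| ≤
        η + B * (energy i (2⁻¹ ^ n') v p - energy i (2⁻¹ ^ n) v p) := by
  obtain ⟨L, hL⟩ := S.exists_lipSupp_χ_mul_v_mul hχ hχ1
  obtain ⟨_, hv⟩ := S.bddLip_v
  have hsmall : ∀ᶠ n' : ℕ in atTop, (2⁻¹ : ℝ) ^ n' * L ≤ δ := by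
    have := (tendsto_pow_atTop_nhds_zero_of_lt_one (r := (2⁻¹ : ℝ)) (by norm_num)
      (by norm_num)).mul_const (L : ℝ)
    rw [zero_mul] at this
    exact this.eventually_le_const hδ
  filter_upwards [hsmall, eventually_ge_atTop (n + m)] with n' hn' hnm f p hf hp
  have hfv (x : 𝔼 d) : |χ x * v x * f x| ≤ v x := by
    rw [abs_mul, abs_mul, abs_of_nonneg (S.v_nonneg x), mul_right_comm]
    exact mul_le_of_le_one_left (S.v_nonneg x)
      (mul_le_one₀ (hχ1 x) (abs_nonneg _) (by simpa using hf.abs_le x))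
  have hmono : energy i (2⁻¹ ^ n) v p ≤ energy i (2 ^ m * 2⁻¹ ^ n') v p := by
    obtain ⟨l, rfl⟩ := Nat.exists_eq_add_of_le hnm
    have hscale : (2⁻¹ : ℝ) ^ n = 2 ^ l * (2 ^ m * 2⁻¹ ^ (n + m + l)) := by
      rw [pow_add, pow_add]
      simp [field]
    rw [hscale]
    exact energy_two_pow_mul_le (fun k => (hp k).lip.continuous) (fun k => (hp k).hasCompactSupport)
      hv.lip.continuous S.v_nonneg S.v_add_single l
  refine (hosc (by positivity) (pow_le_one₀ (by norm_num) (by norm_num)) hn' (hL f hf)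
    hv.lip.continuous hfv S.v_add_single ((setIntegral_closedBall_le_integral_mul hκ hκ0 hκ1
      ⟨_, hv⟩ S.v_nonneg).trans S.integral_κ_lt.le) hp).trans ?_
  gcongr

theorem abs_integral_χ_mul_succ_le (S : IsStage i χ κ R V c A B T u v z X n)
    (hχ : LipSupp K R χ) (h : ℝ) {f : 𝔼 d → ℝ} {p : Fin d → 𝔼 d → ℝ} (hf : BddLip 1 f)
    (hp : ∀ k, LipSupp 1 R (p k)) :
    |∫ x, χ x * (u x + wave i h x * v x) * f x * jacDet p x| ≤
      A * T + B * energy i (2⁻¹ ^ n) v p +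
        |∫ x, wave i h x * (χ x * v x * f x) * jacDet p x| := by
  obtain ⟨_, hu⟩ := S.bddLip_u
  obtain ⟨_, hv⟩ := S.bddLip_v
  obtain ⟨_, huf⟩ := hχ.exists_mul_bddLip ⟨_, hu.mul hf⟩
  obtain ⟨_, hvf⟩ := hχ.exists_mul_bddLip ⟨_, (bddLip_wave i h).mul (hv.mul hf)⟩
  have hsplit : ∫ x, χ x * (u x + wave i h x * v x) * f x * jacDet p x =
      (∫ x, χ x * u x * f x * jacDet p x) +
        ∫ x, wave i h x * (χ x * v x * f x) * jacDet p x := by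
    rw [← integral_add
      ((huf.integrable_mul_jacDet fun k => (hp k).lip).congr (by simp [mul_assoc]))
      ((hvf.integrable_mul_jacDet fun k => (hp k).lip).congr (by simp [mul_assoc, mul_left_comm]))]
    congr 1 with x
    ring
  rw [hsplit]
  exact (abs_add_le _ _).trans (add_le_add_left (S.pairing f p hf hp) _)

theorem exists_wave_strips (S : IsStage i χ κ R V c A B T u v z X n) (j : Fin d)
    (hχ : LipSupp K R χ) (hχ1 : ∀ x, |χ x| ≤ 1) (hκ : LipSupp Kκ Rκ κ) (hκ0 : ∀ x, 0 ≤ κ x)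
    (hκ1 : ∀ x, ‖x‖ ≤ R → 1 ≤ κ x) (hB : 0 ≤ B) (hδ : 0 < δ) (hη' : 0 < η')
    (hosc : OscillationBound i R V η m B δ) :
    ∃ (n' : ℕ) (N : ℝ),
      Real.pi⁻¹ * (2⁻¹ * c) < ∫ x, gaps j N x * (χ x *
        (wave i (2⁻¹ ^ n') x * (u x * z x + wave i (2⁻¹ ^ n') x * v x))) ∧
      c < ∫ x, χ x * (strips j N x * v x) ∧ ∫ x, κ x * (strips j N x * v x) < V ∧
      ∀ (f : 𝔼 d → ℝ) (p : Fin d → 𝔼 d → ℝ), BddLip 1 f → (∀ k, LipSupp 1 R (p k)) →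
        |∫ x, wave i (2⁻¹ ^ n') x * (χ x * v x * f x) * jacDet p x| +
          B * energy i (2⁻¹ ^ n) v p ≤
            η + B * η' + B * energy i (2⁻¹ ^ n') (fun x => strips j N x * v x) p := by
  obtain ⟨_, hu⟩ := S.bddLip_u
  obtain ⟨_, hv⟩ := S.bddLip_v
  obtain ⟨_, hz⟩ := S.bddLip_z
  obtain ⟨n', hgain, hwave⟩ := (((S.tendsto_integral_wave_mul hχ).eventually_const_lt
    (mul_lt_mul_of_pos_left S.lt_integral_χ (by norm_num))).and
      (S.eventually_abs_integral_wave_mul_le hχ hχ1 hκ hκ0 hκ1 hB hδ hosc)).exists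
  have hw := bddLip_wave i ((2 : ℝ)⁻¹ ^ n')
  obtain ⟨_, hχv⟩ := hχ.exists_mul_bddLip S.bddLip_v
  obtain ⟨_, hκv⟩ := hκ.exists_mul_bddLip S.bddLip_v
  obtain ⟨_, hG⟩ := hχ.exists_mul_bddLip ⟨_, hw.mul ((hu.mul hz).add (hw.mul hv))⟩
  obtain ⟨N, hNgain, hNχ, hNκ, hNE⟩ := (((hG.tendsto_integral_gaps_mul j).eventually_const_lt
    (mul_lt_mul_of_pos_left hgain (inv_pos.2 Real.pi_pos))).and
    (((hχv.tendsto_integral_strips_mul j).eventually_const_lt S.lt_integral_χ).and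
    (((hκv.tendsto_integral_strips_mul j).eventually_lt_const S.integral_κ_lt).and
    (hv.eventually_energy_le_energy_strips_mul_add i j R (h := 2⁻¹ ^ n') hη')))).exists
  refine ⟨n', N, hNgain, by simpa only [mul_left_comm] using hNχ,
    by simpa only [mul_left_comm] using hNκ, fun f p hf hp => ?_⟩
  have hE := mul_le_mul_of_nonneg_left (hNE p hp) hB
  linarith [hwave f p hf hp]

theorem abs_X_succ_add_z_succ_le (S : IsStage i χ κ R V c A B T u v z X n) (h : ℝ) (j : Fin d)
    (N : ℝ) (x : 𝔼 d) :
    |X x + wave i h x * z x * gaps j N x| + z x * (1 - gaps j N x) ≤ 1 := by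
  have hzg : 0 ≤ z x * gaps j N x := mul_nonneg (S.z_nonneg x) (gaps_nonneg j N x)
  have hstep : |wave i h x * z x * gaps j N x| ≤ z x * gaps j N x := by
    rw [mul_assoc, abs_mul, abs_of_nonneg hzg]
    exact mul_le_of_le_one_left hzg (abs_wave_le_one i h x)
  linarith [abs_add_le (X x) (wave i h x * z x * gaps j N x), S.abs_X_add_z_le x]

theorem exists_succ (S : IsStage i χ κ R V c (η + B * η') B T u v z X n) (hij : i ≠ j)
    (hχ : LipSupp K R χ) (hχ1 : ∀ x, |χ x| ≤ 1) (hκ : LipSupp Kκ Rκ κ) (hκ0 : ∀ x, 0 ≤ κ x)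
    (hκ1 : ∀ x, ‖x‖ ≤ R → 1 ≤ κ x) (hB : 0 ≤ B) (hδ : 0 < δ) (hη' : 0 < η')
    (hosc : OscillationBound i R V η m B δ) :
    ∃ u' v' z' X' n', IsStage i χ κ R V c (η + B * η') B (T + 1) u' v' z' X' n' := by
  obtain ⟨_, hu⟩ := S.bddLip_u
  obtain ⟨_, hv⟩ := S.bddLip_v
  obtain ⟨_, hz⟩ := S.bddLip_z
  obtain ⟨_, hX⟩ := S.bddLip_X
  obtain ⟨n', N, hgain, hNχ, hNκ, hpair⟩ :=
    S.exists_wave_strips j hχ hχ1 hκ hκ0 hκ1 hB hδ hη' hosc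
  let w := wave i ((2 : ℝ)⁻¹ ^ n')
  have hw : BddLip _ w := bddLip_wave i ((2 : ℝ)⁻¹ ^ n')
  refine ⟨fun x => u x + w x * v x, fun x => strips j N x * v x, fun x => z x * (1 - gaps j N x),
    fun x => X x + w x * z x * gaps j N x, n', ?_⟩
  exact
  { bddLip_u := ⟨_, hu.add (hw.mul hv)⟩
    bddLip_v := ⟨_, (bddLip_strips j N).mul hv⟩
    bddLip_z := ⟨_, hz.mul (bddLip_one_sub_gaps j N)⟩
    bddLip_X := ⟨_, hX.add ((hw.mul hz).mul (bddLip_gaps j N))⟩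
    v_nonneg := fun x => mul_nonneg (strips_nonneg j N x) (S.v_nonneg x)
    z_nonneg := fun x => mul_nonneg (S.z_nonneg x) (sub_nonneg.2 (gaps_le_one j N x))
    v_add_single := fun x t => by simp [strips, S.v_add_single, hij.symm]
    v_mul_z := fun x => by
      linear_combination strips j N x * (1 - gaps j N x) * S.v_mul_z x -
        v x * strips_mul_gaps j N x
    v_mul_X := fun x => by
      linear_combination strips j N x * S.v_mul_X x + v x * w x * z x * strips_mul_gaps j N x
    abs_X_add_z_le := S.abs_X_succ_add_z_succ_le _ j N
    integral_κ_lt := hNκ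
    lt_integral_χ := hNχ
    mass := by
      rw [S.integral_χ_mul_succ hχ j N]
      refine le_trans (le_of_eq ?_) (add_le_add S.mass hgain.le)
      field_simp
    pairing := fun f p hf hp => by
      refine (S.abs_integral_χ_mul_succ_le hχ (2⁻¹ ^ n') hf hp).trans ?_
      linarith [hpair f p hf hp] }

theorem exists_of_oscillationBound (hij : i ≠ j) (hχ : LipSupp K R χ) (hχ1 : ∀ x, |χ x| ≤ 1)
    (hκ : LipSupp Kκ Rκ κ) (hκ0 : ∀ x, 0 ≤ κ x) (hκ1 : ∀ x, ‖x‖ ≤ R → 1 ≤ κ x)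
    (hV : ∫ x, κ x < V) (hc : c < ∫ x, χ x) (hB : 0 ≤ B)
    (hδ : 0 < δ) (hη' : 0 < η') (hosc : OscillationBound i R V η m B δ) (T : ℕ) :
    ∃ u v z X n, IsStage i χ κ R V c (η + B * η') B T u v z X n := by
  induction T with
  | zero => exact ⟨_, _, _, _, _, by simpa using zero hB hV hc⟩
  | succ T ih =>
    obtain ⟨u, v, z, X, n, S⟩ := ih
    simpa using S.exists_succ hij hχ hχ1 hκ hκ0 hκ1 hB hδ hη' hosc

theorem mass_le_integral_abs (S : IsStage i χ κ R V c A B T u v z X n) (hχ : LipSupp K R χ) :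
    c / (2 * Real.pi) * T ≤ ∫ x, |χ x * u x| := by
  obtain ⟨_, hu⟩ := S.bddLip_u
  obtain ⟨_, hX⟩ := S.bddLip_X
  obtain ⟨_, hχu⟩ := hχ.exists_mul_bddLip S.bddLip_u
  obtain ⟨_, hχuX⟩ := hχ.exists_mul_bddLip ⟨_, hu.mul hX⟩
  refine S.mass.trans (integral_mono hχuX.integrable hχu.integrable.abs fun x => ?_)
  refine (le_abs_self _).trans ?_
  rw [← mul_assoc, abs_mul]
  exact mul_le_of_le_one_right (abs_nonneg _) (by linarith [S.abs_X_add_z_le x, S.z_nonneg x])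

end IsStage

theorem exists_lipSupp_one_le (r : ℝ) :
    ∃ κ : 𝔼 d → ℝ, LipSupp 1 (r + 1) κ ∧ (∀ x, 0 ≤ κ x) ∧ ∀ x, ‖x‖ ≤ r → 1 ≤ κ x :=
  ⟨fun x => max 0 (r + 1 - ‖x‖), ⟨by
      simpa using ((LipschitzWith.const (r + 1)).sub lipschitzWith_one_norm).const_max 0,
    fun _ hx => max_eq_left (by linarith)⟩, fun _ => le_max_left _ _,
    fun _ hx => le_max_of_le_right (by linarith)⟩

-- The mass grows linearly in the number `T` of steps, with a much larger slope than the pairings.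
theorem exists_mass_and_pairing_le (hd : 2 ≤ d) (hχ : LipSupp K R χ) (hχ1 : ∀ x, |χ x| ≤ 1)
    (hpos : 0 < ∫ x, χ x) {ε : ℝ} (hε : 0 < ε) :
    ∃ (u : 𝔼 d → ℝ) (M : ℝ), (∃ K, BddLip K u) ∧ 0 < M ∧ M ≤ ∫ x, |χ x * u x| ∧
      ∀ (f : 𝔼 d → ℝ) (p : Fin d → 𝔼 d → ℝ), BddLip 1 f → (∀ k, LipSupp 1 R (p k)) →
        |∫ x, χ x * u x * f x * jacDet p x| ≤ ε * M := by
  have := Fin.nontrivial_iff_two_le.2 hd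
  obtain ⟨i, j, hij⟩ := exists_pair_ne (Fin d)
  obtain ⟨κ, hκ, hκ0, hκ1⟩ := exists_lipSupp_one_le (d := d) (R + 1)
  obtain ⟨c, hc, hcχ⟩ := exists_between hpos
  obtain ⟨V, hV⟩ := exists_gt (∫ x, κ x)
  let a := c / (2 * Real.pi)
  have : 0 < a := by positivity
  obtain ⟨m, B, δ, hB, hδ, hosc⟩ := exists_oscillationBound i R V (η := ε * a / 4) (by positivity)
  let η' := ε * a / (4 * (B + 1))
  have hη' : 0 < η' := by positivity
  have hBη' : B * η' ≤ ε * a / 4 := by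
    have : η' * (4 * (B + 1)) = ε * a := div_mul_cancel₀ _ (by positivity)
    linarith
  obtain ⟨T, hT, hT0⟩ := ((tendsto_natCast_atTop_atTop.eventually_gt_atTop
    (B * (d * V) / (ε * a / 2))).and (eventually_gt_atTop 0)).exists
  rw [div_lt_iff₀ (by positivity)] at hT
  obtain ⟨u, v, z, X, n, S⟩ := IsStage.exists_of_oscillationBound hij hχ hχ1 hκ hκ0
    (fun x hx => hκ1 x (hx.trans (by linarith))) hV hcχ hB hδ hη' hosc T
  refine ⟨u, a * T, S.bddLip_u, by positivity, S.mass_le_integral_abs hχ, fun f p hf hp => ?_⟩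
  have hscale : |(2⁻¹ : ℝ) ^ n| ≤ 1 := by
    rw [abs_of_nonneg (by positivity)]
    exact pow_le_one₀ (by norm_num) (by norm_num)
  have henergy : B * energy i (2⁻¹ ^ n) v p ≤ B * (d * V) := by
    gcongr
    refine (energy_le_mul_integral_mul hscale hp hκ hκ0 hκ1 S.bddLip_v S.v_nonneg).trans ?_
    gcongr
    exact S.integral_κ_lt.le
  have hrate : (ε * a / 4 + B * η') * T ≤ ε * a / 2 * T := by
    gcongr
    linarith
  linarith [S.pairing f p hf hp]

theorem exists_lipSupp_pairing_le (hd : 2 ≤ d) (hχ : LipSupp K R χ) (hχ1 : ∀ x, |χ x| ≤ 1)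
    (hpos : 0 < ∫ x, χ x) {ε : ℝ} (hε : 0 < ε) :
    ∃ (w : 𝔼 d → ℝ) (C : ℝ≥0), LipSupp C R w ∧ (∀ x, χ x = 0 → w x = 0) ∧ 1 ≤ ∫ x, |w x| ∧
      ∀ (f : 𝔼 d → ℝ) (p : Fin d → 𝔼 d → ℝ), BddLip 1 f → (∀ k, LipSupp 1 R (p k)) →
        |∫ x, w x * f x * jacDet p x| ≤ ε := by
  obtain ⟨u, M, hu, hM, hmass, hpair⟩ := exists_mass_and_pairing_le hd hχ hχ1 hpos hε
  obtain ⟨_, hχu⟩ := hχ.exists_mul_bddLip hu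
  obtain ⟨C, hw⟩ := hχu.mul_lipschitz (LipschitzWith.const M⁻¹)
  refine ⟨fun x => M⁻¹ * (χ x * u x), C, hw, fun x hx => by simp [hx], ?_, fun f p hf hp => ?_⟩
  · simp_rw [abs_mul M⁻¹, abs_of_pos (inv_pos.2 hM)]
    rw [integral_const_mul, inv_mul_eq_div, one_le_div hM]
    exact hmass
  · simp_rw [mul_assoc M⁻¹]
    rw [integral_const_mul, abs_mul, abs_of_pos (inv_pos.2 hM), inv_mul_eq_div, div_le_iff₀ hM]
    exact hpair f p hf hp

end Construction

section Extension

variable {α : Type*} [PseudoMetricSpace α] {s : Set α} {f : α → ℝ} {b : ℝ≥0}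

theorem exists_lipschitzWith_one_eq_mul (hb : 0 < b) (hf : LipschitzOnWith b f s) :
    ∃ g : α → ℝ, LipschitzWith 1 g ∧ ∀ x ∈ s, f x = b * g x := by
  have hb' : (0 : ℝ) < b := hb
  have hscale : LipschitzOnWith 1 (fun x => f x / b) s :=
    LipschitzOnWith.of_dist_le_mul fun x hx y hy => by
      rw [Real.dist_eq, ← sub_div, abs_div, abs_of_pos hb', div_le_iff₀ hb', NNReal.coe_one,
        one_mul, mul_comm]
      exact hf.dist_le_mul x hx y hy
  obtain ⟨g, hg, hfg⟩ := hscale.extend_real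
  exact ⟨g, hg, fun x hx => by rw [← hfg hx, mul_div_cancel₀ _ hb'.ne']⟩

end Extension

section Cube

theorem norm_le_of_mem_cube {x : 𝔼 d} (hx : x ∈ cube d) : ‖x‖ ≤ d := by
  have hsq : ‖x‖ ^ 2 ≤ d := by
    rw [EuclideanSpace.norm_sq_eq]
    calc ∑ i, ‖x i‖ ^ 2 ≤ ∑ _i : Fin d, (1 : ℝ) := Finset.sum_le_sum fun i _ => by
          rw [Real.norm_eq_abs, sq_abs]
          exact pow_le_one₀ (hx i).1 (hx i).2
      _ = d := by simp
  have hd : (d : ℝ) ≤ (d : ℝ) ^ 2 := by exact_mod_cast Nat.le_self_pow two_ne_zero d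
  exact le_of_sq_le_sq (hsq.trans hd) d.cast_nonneg

theorem zero_mem_cube : (0 : 𝔼 d) ∈ cube d := fun _ => by simp

theorem IsLip.coord {π : 𝔼 d → 𝔼 d} (h : IsLip π) (j : Fin d) : IsLip fun x => π x j := by
  obtain ⟨K, hK⟩ := h
  exact ⟨1 * K, (lipschitzWith_coord j).comp_lipschitzOnWith hK⟩

theorem lipschitzOnWith_of_lipConst_lt {g : 𝔼 d → ℝ} (h : IsLip g) {L : ℝ≥0}
    (hL : lipConst g < L) : LipschitzOnWith L g (cube d) := by
  obtain ⟨K, hK, hlt⟩ := exists_lt_of_csInf_lt (s := {K : ℝ≥0 | LipschitzOnWith K g (cube d)}) h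
    (by exact_mod_cast hL)
  exact LipschitzOnWith.weaken hK hlt.le

theorem abs_le_supNorm {g : 𝔼 d → ℝ} (h : IsLip g) {x : 𝔼 d} (hx : x ∈ cube d) :
    |g x| ≤ supNorm g := by
  obtain ⟨K, hK⟩ := h
  refine le_ciSup (f := fun y : cube d => |g y|) ⟨|g 0| + K * d, ?_⟩ ⟨x, hx⟩
  rintro _ ⟨y, rfl⟩
  calc |g y| ≤ |g 0| + |g y - g 0| := by linarith [abs_sub_abs_le_abs_sub (g y) (g 0)]
    _ ≤ |g 0| + K * ‖(y : 𝔼 d)‖ := by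
      simpa [Real.dist_eq] using hK.dist_le_mul y y.2 0 zero_mem_cube
    _ ≤ |g 0| + K * d := by gcongr; exact norm_le_of_mem_cube y.2

theorem lipConst_nonneg (g : 𝔼 d → ℝ) : 0 ≤ lipConst g := NNReal.coe_nonneg _

theorem supNorm_nonneg (g : 𝔼 d → ℝ) : 0 ≤ supNorm g :=
  Real.iSup_nonneg fun _ => abs_nonneg _

theorem pairSize_nonneg (f : 𝔼 d → ℝ) (π : 𝔼 d → 𝔼 d) : 0 ≤ pairSize f π :=
  mul_nonneg (le_max_of_le_right (supNorm_nonneg f))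
    (Finset.prod_nonneg fun _ _ => lipConst_nonneg _)

theorem exists_bddLip_eq_mul {f : 𝔼 d → ℝ} {F : ℝ≥0} (hF : 0 < F)
    (hf : LipschitzOnWith F f (cube d)) (hf' : ∀ x ∈ cube d, |f x| ≤ F) :
    ∃ g : 𝔼 d → ℝ, BddLip 1 g ∧ ∀ x ∈ cube d, f x = F * g x := by
  obtain ⟨g, hg, hfg⟩ := exists_lipschitzWith_one_eq_mul hF hf
  refine ⟨fun x => max (-1) (min 1 (g x)), ⟨(hg.const_min 1).const_max (-1), fun x => ?_⟩,
    fun x hx => ?_⟩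
  · rw [NNReal.coe_one]
    exact abs_le.2 ⟨le_max_left _ _, max_le (by norm_num) (min_le_left _ _)⟩
  · have hgx : |g x| ≤ 1 := by
      have := hf' x hx
      rwa [hfg x hx, abs_mul, NNReal.abs_eq, mul_le_iff_le_one_right (by exact_mod_cast hF)] at this
    beta_reduce
    rw [min_eq_right (abs_le.1 hgx).2, max_eq_right (abs_le.1 hgx).1, hfg x hx]

theorem exists_lipSupp_eq_add_mul {q : 𝔼 d → ℝ} {b : ℝ≥0} (hb : 0 < b)
    (hq : LipschitzOnWith b q (cube d)) :
    ∃ p : 𝔼 d → ℝ, LipSupp 1 (2 * d) p ∧ ∀ x ∈ cube d, q x = q 0 + b * p x := by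
  obtain ⟨g, hg, hqg⟩ := exists_lipschitzWith_one_eq_mul hb hq
  set ψ : 𝔼 d → ℝ := fun x => max 0 (2 * (d : ℝ) - ‖x‖)
  have hψ : LipschitzWith 1 ψ := by
    simpa using ((LipschitzWith.const (2 * (d : ℝ))).sub lipschitzWith_one_norm).const_max 0
  have hg₀ : LipschitzWith 1 fun x => g x - g 0 := by
    simpa using hg.sub (LipschitzWith.const (g 0))
  refine ⟨fun x => max (-ψ x) (min (g x - g 0) (ψ x)), ⟨?_, fun x hx => ?_⟩, fun x hx => ?_⟩
  · simpa using hψ.neg.max (hg₀.min hψ)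
  · have hψx : ψ x = 0 := max_eq_left (by linarith)
    simp [hψx]
  · have hgx : |g x - g 0| ≤ ψ x := by
      refine le_max_of_le_right ?_
      have := hg.dist_le_mul x 0
      rw [Real.dist_eq, dist_zero_right, NNReal.coe_one, one_mul] at this
      linarith [norm_le_of_mem_cube hx]
    beta_reduce
    rw [min_eq_left (abs_le.1 hgx).2, max_eq_right (abs_le.1 hgx).1, hqg x hx, hqg 0 zero_mem_cube]
    ring

theorem det_fderiv_eq_jacDet {π : 𝔼 d → 𝔼 d} {x : 𝔼 d} (hπ : DifferentiableAt ℝ π x) :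
    (fderiv ℝ π x).det = jacDet (fun j y => π y j) x := by
  rw [det_eq_det_of_single, jacDet]
  congr 1
  ext j i
  have hj : HasFDerivAt (fun y => π y j) ((EuclideanSpace.proj j).comp (fderiv ℝ π x)) x :=
    (EuclideanSpace.proj (𝕜 := ℝ) j).hasFDerivAt.comp x hπ.hasFDerivAt
  simp [gradMat, hj.fderiv]

theorem jac_eq_prod_mul_jacDet {π : 𝔼 d → 𝔼 d} {p : Fin d → 𝔼 d → ℝ} {a b : Fin d → ℝ} {x : 𝔼 d}
    (hx : cube d ∈ 𝓝 x) (hp : ∀ j, DifferentiableAt ℝ (p j) x)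
    (h : ∀ j, ∀ y ∈ cube d, π y j = a j + b j * p j y) :
    jac π x = (∏ j, b j) * jacDet p x := by
  have hπ (j : Fin d) : HasFDerivAt (fun y => π y j) (b j • fderiv ℝ (p j) x) x :=
    (((hp j).hasFDerivAt.const_mul (b j)).const_add (a j)).congr_of_eventuallyEq
      (mem_of_superset hx (h j))
  rw [jac, fderivWithin_of_mem_nhds hx, det_fderiv_eq_jacDet
    (differentiableAt_euclidean.2 fun j => (hπ j).differentiableAt), jacDet, jacDet,
    ← Matrix.det_mul_column]
  congr 1
  ext j i
  simp [gradMat, (hπ j).fderiv]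

theorem exists_ae_mul_jac_eq {f : 𝔼 d → ℝ} {π : 𝔼 d → 𝔼 d} (hf : IsLip f) (hπ : IsLip π)
    {F : ℝ≥0} {b : Fin d → ℝ≥0} (hF : lipConst f < F) (hF' : supNorm f ≤ F)
    (hb : ∀ j, lipConst (fun x => π x j) < b j) :
    ∃ (g : 𝔼 d → ℝ) (p : Fin d → 𝔼 d → ℝ), BddLip 1 g ∧ (∀ j, LipSupp 1 (2 * d) (p j)) ∧
      ∀ᵐ x, cube d ∈ 𝓝 x →
        f x * jac π x = (F * ∏ j, (b j : ℝ)) * (g x * jacDet p x) := by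
  obtain ⟨g, hg, hfg⟩ := exists_bddLip_eq_mul (by exact_mod_cast (lipConst_nonneg f).trans_lt hF)
    (lipschitzOnWith_of_lipConst_lt hf hF) fun x hx => (abs_le_supNorm hf hx).trans hF'
  choose p hp hπp using fun j => exists_lipSupp_eq_add_mul
    (by exact_mod_cast (lipConst_nonneg _).trans_lt (hb j))
    (lipschitzOnWith_of_lipConst_lt (hπ.coord j) (hb j))
  refine ⟨g, p, hg, hp, ?_⟩
  filter_upwards [ae_all_iff.2 fun j => (hp j).lip.ae_differentiableAt] with x hpx hx
  rw [jac_eq_prod_mul_jacDet hx hpx hπp, hfg x (mem_of_mem_nhds hx)]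
  ring

/-- The density `U` pairs with every Lipschitz pair `(f, π)` on the cube with constant `ε`;
equivalently, as a functional on the span of the functions `f det Dπ`, its norm dual to `pairSize`
is at most `ε`. -/
def PairingBound (U : 𝔼 d → ℝ) (ε : ℝ) : Prop :=
  ∀ (f : 𝔼 d → ℝ) (π : 𝔼 d → 𝔼 d), IsLip f → IsLip π →
    Integrable (fun x => U x * f x * jac π x) (cubeVol d) ∧
      |∫ x, U x * f x * jac π x ∂(cubeVol d)| ≤ ε * pairSize f π

variable {w : 𝔼 d → ℝ} {C : ℝ≥0} {ε : ℝ}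

theorem integrable_and_abs_integral_mul_jac_le (hw : LipSupp C (2 * d) w)
    (hw0 : ∀ x, w x ≠ 0 → cube d ∈ 𝓝 x)
    (hpair : ∀ (g : 𝔼 d → ℝ) (p : Fin d → 𝔼 d → ℝ), BddLip 1 g →
      (∀ k, LipSupp 1 (2 * d) (p k)) → |∫ x, w x * g x * jacDet p x| ≤ ε)
    {f : 𝔼 d → ℝ} {π : 𝔼 d → 𝔼 d} (hf : IsLip f) (hπ : IsLip π)
    {F : ℝ≥0} {b : Fin d → ℝ≥0} (hF : lipConst f < F) (hF' : supNorm f ≤ F)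
    (hb : ∀ j, lipConst (fun x => π x j) < b j) :
    Integrable (fun x => w x * f x * jac π x) (cubeVol d) ∧
      |∫ x, w x * f x * jac π x ∂(cubeVol d)| ≤ ε * (F * ∏ j, (b j : ℝ)) := by
  obtain ⟨g, p, hg, hp, hfπ⟩ := exists_ae_mul_jac_eq hf hπ hF hF' hb
  set P : ℝ := F * ∏ j, (b j : ℝ)
  have hP : 0 ≤ P := by positivity
  have hoff (x : 𝔼 d) (hx : x ∉ cube d) : w x = 0 :=
    not_not.1 fun h => hx (mem_of_mem_nhds (hw0 x h))
  obtain ⟨_, hgw⟩ := hw.mul_lipschitz hg.lip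
  have hint : Integrable fun x => w x * g x * jacDet p x := by
    simpa only [mul_comm (g _)] using hgw.integrable_mul_jacDet fun j => (hp j).lip
  have hae : ∀ᵐ x ∂(cubeVol d), P * (w x * g x * jacDet p x) = w x * f x * jac π x := by
    refine ae_restrict_of_ae (hfπ.mono fun x hx => ?_)
    rcases eq_or_ne (w x) 0 with h0 | h0
    · simp [h0]
    · rw [mul_assoc (w x) (f x), hx (hw0 x h0)]
      ring
  refine ⟨(hint.restrict.const_mul P).congr hae, ?_⟩
  rw [← integral_congr_ae hae, integral_const_mul, abs_mul, abs_of_nonneg hP, mul_comm ε, cubeVol,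
    setIntegral_eq_integral_of_forall_compl_eq_zero fun x hx => by simp [hoff x hx]]
  exact mul_le_mul_of_nonneg_left (hpair g p hg hp) hP

theorem pairingBound_of_lipSupp (hw : LipSupp C (2 * d) w) (hw0 : ∀ x, w x ≠ 0 → cube d ∈ 𝓝 x)
    (hpair : ∀ (g : 𝔼 d → ℝ) (p : Fin d → 𝔼 d → ℝ), BddLip 1 g →
      (∀ k, LipSupp 1 (2 * d) (p k)) → |∫ x, w x * g x * jacDet p x| ≤ ε) :
    PairingBound w ε := by
  intro f π hf hπ
  obtain ⟨F, hF⟩ : ∃ F : ℝ≥0, F = max (lipConst f) (supNorm f) :=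
    CanLift.prf _ (le_max_of_le_left (lipConst_nonneg f))
  choose b hb using fun j => (⟨_, rfl⟩ : ∃ b : ℝ≥0, (b : ℝ) = lipConst fun x => π x j)
  -- Extending off the cube needs positive Lipschitz constants, hence the perturbation by `δ`.
  have key (δ : ℝ≥0) (hδ : 0 < δ) := integrable_and_abs_integral_mul_jac_le hw hw0 hpair hf hπ
    (F := F + δ) (b := fun j => b j + δ)
    ((le_max_left _ _).trans_lt (by rw [← hF]; exact_mod_cast lt_add_of_pos_right F hδ))
    ((le_max_right _ _).trans (by rw [← hF]; exact_mod_cast le_self_add))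
    fun j => by rw [← hb]; exact_mod_cast lt_add_of_pos_right (b j) hδ
  refine ⟨(key 1 one_pos).1, ?_⟩
  have hlim : Tendsto (fun δ : ℝ≥0 => ε * (((F + δ : ℝ≥0) : ℝ) * ∏ j, ((b j + δ : ℝ≥0) : ℝ)))
      (𝓝[>] 0) (𝓝 (ε * pairSize f π)) := by
    refine Tendsto.mono_left (Continuous.tendsto' (by fun_prop) _ _ ?_) nhdsWithin_le_nhds
    simp only [pairSize, add_zero, hF, hb]
  exact ge_of_tendsto hlim (eventually_mem_nhdsWithin.mono fun δ hδ => (key δ hδ).2)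

end Cube

section Bump

/-- The centre of the cube. -/
noncomputable def cubeCenter (d : ℕ) : 𝔼 d := WithLp.toLp 2 fun _ => 1 / 2

/-- A Lipschitz bump supported in the interior of the cube, which localises the construction
on the whole space to the cube. -/
noncomputable def cubeBump (d : ℕ) (x : 𝔼 d) : ℝ :=
  max 0 (1 / 4 - ‖x - cubeCenter d‖)

theorem cube_mem_nhds_of_cubeBump_ne_zero {x : 𝔼 d} (hx : cubeBump d x ≠ 0) : cube d ∈ 𝓝 x := by
  have hball : x ∈ Metric.ball (cubeCenter d) (1 / 4) := by
    rw [mem_ball_iff_norm]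
    by_contra h
    exact hx (max_eq_left (by linarith))
  refine mem_of_superset (Metric.isOpen_ball.mem_nhds hball) fun y hy i => ?_
  have hyi : |y i - 1 / 2| < 1 / 4 :=
    (PiLp.norm_apply_le (y - cubeCenter d) i).trans_lt (mem_ball_iff_norm.1 hy)
  rw [abs_lt] at hyi
  constructor <;> linarith

theorem cubeBump_eq_zero {x : 𝔼 d} (hx : x ∉ cube d) : cubeBump d x = 0 :=
  not_not.1 fun h => hx (mem_of_mem_nhds (cube_mem_nhds_of_cubeBump_ne_zero h))

theorem abs_cubeBump_le_one (x : 𝔼 d) : |cubeBump d x| ≤ 1 := by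
  rw [cubeBump, abs_of_nonneg (le_max_left _ _)]
  exact max_le zero_le_one (by linarith [norm_nonneg (x - cubeCenter d)])

theorem lipSupp_cubeBump : LipSupp 1 (2 * d) (cubeBump d) where
  lip := show LipschitzWith 1 fun x => max 0 (1 / 4 - ‖x - cubeCenter d‖) by
    simpa [dist_eq_norm] using
      ((LipschitzWith.const (1 / 4 : ℝ)).sub (LipschitzWith.dist_left (cubeCenter d))).const_max 0
  zero x hx := cubeBump_eq_zero fun h => by linarith [norm_le_of_mem_cube h, norm_nonneg x]

theorem integral_cubeBump_pos : 0 < ∫ x, cubeBump d x := by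
  refine (integral_pos_iff_support_of_nonneg (fun x => le_max_left _ _)
    lipSupp_cubeBump.integrable).2 ?_
  refine lipSupp_cubeBump.lip.continuous.isOpen_support.measure_pos volume ⟨cubeCenter d, ?_⟩
  simp [cubeBump]

theorem exists_one_le_integral_abs_pairingBound (hd : 2 ≤ d) {ε : ℝ} (hε : 0 < ε) :
    ∃ U : 𝔼 d → ℝ, Integrable U (cubeVol d) ∧ 1 ≤ ∫ x, |U x| ∂(cubeVol d) ∧
      PairingBound U ε := by
  obtain ⟨w, C, hw, hw0, hmass, hpair⟩ := exists_lipSupp_pairing_le hd lipSupp_cubeBump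
    abs_cubeBump_le_one integral_cubeBump_pos hε
  refine ⟨w, hw.integrable.restrict, ?_, pairingBound_of_lipSupp hw
    (fun x hx => cube_mem_nhds_of_cubeBump_ne_zero (mt (hw0 x) hx)) hpair⟩
  rwa [cubeVol, setIntegral_eq_integral_of_forall_compl_eq_zero fun x hx => by
    rw [hw0 x (cubeBump_eq_zero hx), abs_zero]]

theorem strongNonRegularity (hd : 2 ≤ d) : StrongNonRegularity d := by
  choose u hu hmass hpair using fun n : ℕ =>
    exists_one_le_integral_abs_pairingBound hd (Nat.one_div_pos_of_nat (α := ℝ) (n := n))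
  refine ⟨fun n => u (n - 1), fun n hn => ⟨hu _, hmass _, fun f π hf hπ hs => ?_⟩⟩
  refine ((hpair (n - 1) f π hf hπ).2.trans
    (mul_le_of_le_one_right Nat.one_div_pos_of_nat.le hs)).trans_eq ?_
  rw [← Nat.cast_succ, Nat.succ_eq_add_one, Nat.sub_add_cancel hn]

end Bump

section Duality

theorem tendsto_integral_mul_of_eLpNorm_top {α : Type*} [MeasurableSpace α] {μ : Measure α}
    {U ρ : α → ℝ} {S : ℕ → α → ℝ} (hU : Integrable U μ) (hρ : Integrable (fun x => U x * ρ x) μ)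
    (hS : ∀ N, Integrable (fun x => U x * S N x) μ)
    (h : Tendsto (fun N => eLpNorm (fun x => S N x - ρ x) ∞ μ) atTop (𝓝 0)) :
    Tendsto (fun N => ∫ x, U x * S N x ∂μ) atTop (𝓝 (∫ x, U x * ρ x ∂μ)) := by
  have hlim : Tendsto (fun N => (eLpNorm (fun x => S N x - ρ x) ∞ μ).toReal * ∫ x, |U x| ∂μ) atTop
      (𝓝 0) := by
    simpa using ((ENNReal.tendsto_toReal ENNReal.zero_ne_top).comp h).mul_const (∫ x, |U x| ∂μ)
  refine tendsto_iff_dist_tendsto_zero.2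
    (squeeze_zero' (Eventually.of_forall fun _ => dist_nonneg) ?_ hlim)
  filter_upwards [h.eventually_lt_const ENNReal.zero_lt_top] with N hN
  rw [dist_eq_norm, ← integral_sub (hS N) hρ, ← integral_const_mul]
  refine norm_integral_le_of_norm_le (hU.abs.const_mul _) ?_
  rw [eLpNorm_exponent_top] at hN ⊢
  filter_upwards [ae_le_eLpNormEssSup (f := fun x => S N x - ρ x) (μ := μ)] with x hx
  rw [← mul_sub, norm_mul, mul_comm, Real.norm_eq_abs (U x)]
  refine mul_le_mul_of_nonneg_right ?_ (abs_nonneg _)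
  rw [← toReal_enorm]
  exact ENNReal.toReal_mono hN.ne hx

theorem PairingBound.abs_integral_mul_le_tsum {U ρ : 𝔼 d → ℝ} {ε : ℝ} (h : PairingBound U ε)
    (hε : 0 ≤ ε) (hU : Integrable U (cubeVol d)) (hρ : MemLp ρ ∞ (cubeVol d))
    {f : ℕ → 𝔼 d → ℝ} {π : ℕ → 𝔼 d → 𝔼 d} (S : IsLipschitzSolution ρ f π) :
    |∫ x, U x * ρ x ∂(cubeVol d)| ≤ ε * ∑' i, pairSize (f i) (π i) := by
  have hI (i : ℕ) := h (f i) (π i) (S.lip_coeff i) (S.lip_field i)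
  have hsum (N : ℕ) : (fun x => U x * ∑ i ∈ Finset.range N, f i x * jac (π i) x) =
      fun x => ∑ i ∈ Finset.range N, U x * f i x * jac (π i) x := by
    simp_rw [Finset.mul_sum, mul_assoc]
  have hlim := tendsto_integral_mul_of_eLpNorm_top hU (hU.mul_of_top_left hρ)
    (fun N => by rw [hsum]; exact integrable_finsetSum _ fun i _ => (hI i).1) S.conv
  refine le_of_tendsto hlim.abs (Eventually.of_forall fun N => ?_)
  rw [hsum, integral_finsetSum _ fun i _ => (hI i).1]
  calc |∑ i ∈ Finset.range N, ∫ x, U x * f i x * jac (π i) x ∂(cubeVol d)|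
      ≤ ∑ i ∈ Finset.range N, ε * pairSize (f i) (π i) :=
        (Finset.abs_sum_le_sum_abs _ _).trans (Finset.sum_le_sum fun i _ => (hI i).2)
    _ = ε * ∑ i ∈ Finset.range N, pairSize (f i) (π i) := (Finset.mul_sum _ _ _).symm
    _ ≤ ε * ∑' i, pairSize (f i) (π i) := mul_le_mul_of_nonneg_left
        (S.finite_size.sum_le_tsum _ fun i _ => pairSize_nonneg _ _) hε

section UniformBoundedness

variable {α : Type*} [MeasurableSpace α] {μ : Measure α} {U : α → ℝ}

theorem exists_memLp_top_mul_eq_abs (hU : AEStronglyMeasurable U μ) :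
    ∃ s : α → ℝ, MemLp s ∞ μ ∧ eLpNorm s ∞ μ ≤ 1 ∧ ∀ x, U x * s x = |U x| := by
  have hb : eLpNorm (fun x => U x / |U x|) ∞ μ ≤ 1 := by
    rw [eLpNorm_exponent_top, ← ENNReal.ofReal_one]
    refine eLpNormEssSup_le_of_ae_bound (Eventually.of_forall fun x => ?_)
    rw [Real.norm_eq_abs, abs_div, abs_abs]
    exact div_self_le_one _
  refine ⟨fun x => U x / |U x|, ⟨(hU.aemeasurable.div hU.aemeasurable.abs).aestronglyMeasurable,
    hb.trans_lt ENNReal.one_lt_top⟩, hb, fun x => ?_⟩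
  rw [mul_div_assoc', ← abs_mul_abs_self, mul_self_div_self]

theorem exists_continuousLinearMap_eq_integral_mul (hU : Integrable U μ) :
    ∃ g : Lp ℝ ∞ μ →L[ℝ] ℝ, ∀ ρ : Lp ℝ ∞ μ, g ρ = ∫ x, U x * ρ x ∂μ := by
  have hU1 : MemLp U 1 μ := memLp_one_iff_integrable.2 hU
  refine ⟨(ContinuousLinearMap.mul ℝ ℝ).lpPairing μ 1 ∞ (hU1.toLp U), fun ρ => ?_⟩
  rw [ContinuousLinearMap.lpPairing_eq_integral]
  refine integral_congr_ae ?_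
  filter_upwards [hU1.coeFn_toLp] with x hx
  rw [hx, ContinuousLinearMap.mul_apply']

theorem exists_integral_abs_le_of_forall_memLp_top {U : ℕ → α → ℝ} (hU : ∀ n, Integrable (U n) μ)
    (h : ∀ ρ, MemLp ρ ∞ μ → ∃ C, ∀ n, |∫ x, U n x * ρ x ∂μ| ≤ C) :
    ∃ C, ∀ n, ∫ x, |U n x| ∂μ ≤ C := by
  choose g hg using fun n => exists_continuousLinearMap_eq_integral_mul (hU n)
  obtain ⟨C, hC⟩ := banach_steinhaus (g := g) fun ρ => by
    simpa only [hg, Real.norm_eq_abs] using h ρ (Lp.memLp ρ)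
  refine ⟨C, fun n => ?_⟩
  obtain ⟨s, hs, hs1, hUs⟩ := exists_memLp_top_mul_eq_abs (hU n).1
  have hnorm : ‖hs.toLp s‖ ≤ 1 := by
    rw [Lp.norm_toLp]
    exact ENNReal.toReal_le_of_le_ofReal zero_le_one (by rwa [ENNReal.ofReal_one])
  calc ∫ x, |U n x| ∂μ = g n (hs.toLp s) := by
        rw [hg]
        refine integral_congr_ae (hs.coeFn_toLp.mono fun x hx => ?_)
        beta_reduce
        rw [hx, hUs]
    _ ≤ C * 1 := (le_abs_self _).trans ((g n).le_of_opNorm_le_of_le (hC n) hnorm)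
    _ = C := mul_one C

end UniformBoundedness

-- If every `ρ` were representable, the functionals `n U_n` would be pointwise bounded on `L^∞`,
-- although their norms are at least `n`.
theorem exists_memLp_not_isLipschitzSolution (hd : 2 ≤ d) :
    ∃ ρ : 𝔼 d → ℝ, MemLp ρ ∞ (cubeVol d) ∧
      ¬ ∃ (f : ℕ → 𝔼 d → ℝ) (π : ℕ → 𝔼 d → 𝔼 d), IsLipschitzSolution ρ f π := by
  by_contra! hcon
  choose U hU hmass hpair using fun n : ℕ =>
    exists_one_le_integral_abs_pairingBound hd (Nat.one_div_pos_of_nat (α := ℝ) (n := n))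
  have hscaled : ∀ ρ, MemLp ρ ∞ (cubeVol d) →
      ∃ C, ∀ n : ℕ, |∫ x, ((n : ℝ) + 1) * U n x * ρ x ∂(cubeVol d)| ≤ C := by
    intro ρ hρ
    obtain ⟨f, π, S⟩ := hcon ρ hρ
    refine ⟨∑' i, pairSize (f i) (π i), fun n => ?_⟩
    have hn : (0 : ℝ) < n + 1 := n.cast_add_one_pos
    have hle := (hpair n).abs_integral_mul_le_tsum Nat.one_div_pos_of_nat.le (hU n) hρ S
    simp_rw [mul_assoc]
    rwa [integral_const_mul, abs_mul, abs_of_pos hn, ← le_div_iff₀' hn, div_eq_mul_one_div,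
      mul_comm]
  obtain ⟨C, hC⟩ := exists_integral_abs_le_of_forall_memLp_top (fun n => (hU n).const_mul _) hscaled
  obtain ⟨n, hn⟩ := exists_nat_gt C
  have hCn := hC n
  simp_rw [abs_mul, integral_const_mul, abs_of_pos (n.cast_add_one_pos (α := ℝ))] at hCn
  linarith [le_mul_of_one_le_right (n.cast_add_one_pos (α := ℝ)).le (hmass n)]

theorem lipConst_zero : lipConst (fun _ : 𝔼 d => (0 : ℝ)) = 0 := by
  rw [lipConst, NNReal.coe_eq_zero]
  exact le_antisymm (csInf_le (OrderBot.bddBelow _) (LipschitzWith.const (0 : ℝ)).lipschitzOnWith)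
    zero_le

theorem pairSize_zero (π : 𝔼 d → 𝔼 d) : pairSize (fun _ => 0) π = 0 := by
  simp [pairSize, lipConst_zero, supNorm]

theorem IsJacobianSolution.isLipschitzSolution {ρ : 𝔼 d → ℝ} {π : 𝔼 d → 𝔼 d}
    (h : IsJacobianSolution ρ π) (hρ : MemLp ρ ∞ (cubeVol d)) :
    IsLipschitzSolution ρ (fun i _ => if i = 0 then 1 else 0) fun _ => π where
  lip_coeff i := ⟨0, (LipschitzWith.const _).lipschitzOnWith⟩
  lip_field _ := h.1
  finite_size := summable_of_ne_finset_zero (s := {0}) fun i hi => by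
    have : i ≠ 0 := by simpa using hi
    simp [this, pairSize_zero]
  abs_conv := by
    rw [tsum_eq_single 0 fun i hi => by simp only [if_neg hi, zero_mul, eLpNorm_zero']]
    simpa [eLpNorm_congr_ae h.2] using hρ.2
  conv := by
    refine tendsto_const_nhds.congr' ?_
    filter_upwards [eventually_ge_atTop 1] with N hN
    rw [eq_comm, ← eLpNorm_zero (α := 𝔼 d) (ε := ℝ) (p := ∞) (μ := cubeVol d)]
    refine eLpNorm_congr_ae (h.2.mono fun x hx => ?_)
    have h0 : 0 ∈ Finset.range N := Finset.mem_range.2 hN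
    simp [ite_mul, Finset.sum_ite_eq', h0, hx]

end Duality

end PrescribedJacobian

theorem theorem1p1 (d : ℕ) (hd : 2 ≤ d) :
    PrescribedJacobian.StrongNonRegularity d ∧
    ∃ ρ : EuclideanSpace ℝ (Fin d) → ℝ,
      MemLp ρ ∞ (PrescribedJacobian.cubeVol d) ∧
      (¬ ∃ (f : ℕ → EuclideanSpace ℝ (Fin d) → ℝ)
          (π : ℕ → EuclideanSpace ℝ (Fin d) → EuclideanSpace ℝ (Fin d)),
          PrescribedJacobian.IsLipschitzSolution ρ f π) ∧
      (¬ ∃ π : EuclideanSpace ℝ (Fin d) → EuclideanSpace ℝ (Fin d),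
          PrescribedJacobian.IsJacobianSolution ρ π) := by
  obtain ⟨ρ, hρ, hno⟩ := PrescribedJacobian.exists_memLp_not_isLipschitzSolution hd
  exact ⟨PrescribedJacobian.strongNonRegularity hd, ρ, hρ, hno,
    fun ⟨_, h⟩ => hno ⟨_, _, h.isLipschitzSolution hρ⟩⟩
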